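/- Let $\Omega\subseteq\mathbb{R}^n$ be an open set, $\mu$ a Borel measure on $\Omega$ and $\ell=\mu(\Omega)\in(0,\infty]$. Denote by $\mathbb{P}([0,\ell])$ the class of all $p\in L^\infty([0,\ell])$, real-valued, such that the limit $p(0)=\lim_{t\to0+}p(t)$ exists and $|p(t)-p(0)|\le \frac{C}{\ln(1/t)}$ for $0<t\le\frac12$, $t<\ell$, and, only in the case $\ell=\infty$, also the limit $p(\infty)=\lim_{t\to\infty}p(t)$ exists and $|p(t)-p(\infty)|\le\frac{C}{\ln(e+t)}$ for $t>0$. Let $\mathbb{P}_1([0,\ell])$ be the class of those $p\in\mathbb{P}([0,\ell])$ with $1<\inf_{0<t<\ell}p(t)\le\sup_{0<t<\ell}p(t)<\infty$. For a $\mu$-measurable function $f$ on $\Omega$ let $f^*(t)=\sup\{s\ge0:\mu(\{x\in\Omega:|f(x)|>s\})>t\}$ be its non-increasing rearrangement (with $\sup\emptyset=0$). For $p,q\in\mathbb{P}_1([0,\ell])$ and a weight $w\ge0$ on $(0,\ell)$, the weighted Lorentz space $\mathcal{L}^{p(\cdot),q(\cdot)}_w(\Omega)$ consists of all $\mu$-measurable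 $f$ with $$\|f\|_{\mathcal{L}^{p(\cdot),q(\cdot)}_w(\Omega)}=\inf\Big\{\lambda>0:\int_0^\ell\Big(\frac{w(t)\,t^{\frac1{p(t)}-\frac1{q(t)}}f^*(t)}{\lambda}\Big)^{q(t)}dt\le1\Big\}<\infty .$$ Let $$\mathcal{M}f(x)=\sup_{r>0}\frac1{\mu(\Omega\cap B(x,r))}\int_{\Omega\cap B(x,r)}|f(y)|\,d\mu(y),\qquad x\in\Omega,$$ be the (centred) Hardy--Littlewood maximal function, where the quotient is read as $0$ if $\mu(\Omega\cap B(x,r))$ is $0$ or $\infty$. Let $p,q\in\mathbb{P}_1([0,\ell])$ with $p(0)>1$ and, if $\ell=\infty$, $p(\infty)>1$. Let $w(t)=t^{\gamma(t)}$ with $\gamma\in\mathbb{P}([0,\ell])$, $$\gamma(0)<1-\frac1{p(0)}\qquad\text{and, if }\ell=\infty,\qquad\gamma(\infty)<1-\frac1{p(\infty)}.$$ Then the maximal operator is bounded in $\mathcal{L}^{p(\cdot),q(\cdot)}_w(\Omega)$: there is a constant $C<\infty$ such that for every $f\in\mathcal{L}^{p(\cdot),q(\cdot)}_w(\Omega)$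 one has $\mathcal{M}f\in\mathcal{L}^{p(\cdot),q(\cdot)}_w(\Omega)$ and $\|\mathcal{M}f\|_{\mathcal{L}^{p(\cdot),q(\cdot)}_w(\Omega)}\le C\,\|f\|_{\mathcal{L}^{p(\cdot),q(\cdot)}_w(\Omega)}$. -/

import Mathlib

open MeasureTheory Filter Topology Set
open scoped ENNReal NNReal

namespace VariableLorentz

noncomputable section

/-- The interval `(0, ℓ)` of the real line, `0 ≤ ℓ ≤ ∞`. -/
def interval (ℓ : ℝ≥0∞) : Set ℝ := {t | 0 < t ∧ ENNReal.ofReal t < ℓ}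

/-- The class `ℙ([0, ℓ])`: (essentially) bounded measurable functions `p` on `(0, ℓ)` with a limit
`p(0) = p₀` and a logarithmic decay condition at `0` and, only when `ℓ = ∞`, a limit
`p(∞) = pInf` and a logarithmic decay condition at `∞`.  When `ℓ < ∞`, the number `pInf` plays
no role. -/
structure LogDecay (ℓ : ℝ≥0∞) (p : ℝ → ℝ) (p₀ pInf : ℝ) : Prop where
  memLp_top : MemLp p ∞ (volume.restrict (interval ℓ))
  tendsto_zero : Tendsto p (𝓝[>] 0) (𝓝 p₀)
  decay_zero : ∃ C : ℝ, ∀ t ∈ interval ℓ, t ≤ 1 / 2 → |p t - p₀| ≤ C / Real.log (1 / t)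
  tendsto_infty : ℓ = ∞ → Tendsto p atTop (𝓝 pInf)
  decay_infty : ℓ = ∞ →
    ∃ C : ℝ, ∀ t ∈ interval ℓ, |p t - pInf| ≤ C / Real.log (Real.exp 1 + t)

/-- The class `𝒫_a([0, ℓ])`: `a < p₋ ≤ p₊ < ∞`, with `p₋`, `p₊` the infimum and the supremum
of `p` over `(0, ℓ)`. -/
def ExponentClass (ℓ : ℝ≥0∞) (a : ℝ) (p : ℝ → ℝ) : Prop :=
  (∃ m : ℝ, a < m ∧ ∀ t ∈ interval ℓ, m ≤ p t) ∧ ∃ K : ℝ, ∀ t ∈ interval ℓ, p t ≤ K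

/-- The Luxemburg norm `inf {c > 0 : ∫₀^ℓ (h(t) / c) ^ q(t) dt ≤ 1}` of the variable exponent
Lebesgue space `L^{q(·)}([0, ℓ])`, for a nonnegative function `h` (it is `∞` if there is no
such `c`). -/
def luxemburgNorm (ℓ : ℝ≥0∞) (q : ℝ → ℝ) (h : ℝ → ℝ≥0∞) : ℝ≥0∞ :=
  ⨅ (c : ℝ≥0) (_ : 0 < c) (_ : ∫⁻ t in interval ℓ, (h t / c) ^ q t ≤ 1), (c : ℝ≥0∞)

/-- The non-increasing rearrangement `f^*(t) = sup {s ≥ 0 : μ {x : |f x| > s} > t}`.  It is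
defined in the same way for scalar functions and for functions with values in `[0, ∞]`. -/
def rearrangement {X E : Type*} [MeasurableSpace X] [ENorm E] (μ : Measure X) (f : X → E)
    (t : ℝ) : ℝ≥0∞ :=
  sSup {s : ℝ≥0∞ | ENNReal.ofReal t < μ {x | s < ‖f x‖ₑ}}

/-- The norm `‖w(t) t^{1/p(t) - 1/q(t)} f^*(t)‖_{L^{q(·)}([0, ℓ])}`, `ℓ = μ X`, of the weighted
variable exponent Lorentz space. -/
def lorentzNorm {X E : Type*} [MeasurableSpace X] [ENorm E] (μ : Measure X) (p q w : ℝ → ℝ)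
    (f : X → E) : ℝ≥0∞ :=
  luxemburgNorm (μ univ) q
    fun t => ENNReal.ofReal (w t * t ^ (1 / p t - 1 / q t)) * rearrangement μ f t

/-- Membership in the weighted variable exponent Lorentz space `𝓛_w^{p(·),q(·)}`: `f` is
`μ`-measurable with finite norm. -/
def MemLorentz {X E : Type*} [MeasurableSpace X] [TopologicalSpace E] [ENorm E] (μ : Measure X)
    (p q w : ℝ → ℝ) (f : X → E) : Prop :=
  AEStronglyMeasurable f μ ∧ lorentzNorm μ p q w f < ∞

/-- The Hardy–Littlewood maximal function of `f : Ω → 𝕜` with respect to the measure `μ` on `Ω`,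
with values in `[0, ∞]`.  For `x : Ω`, the ball `Metric.ball x r` of the subtype `Ω` is
`Ω ∩ B(x, r)`.  A ball of measure zero or infinity contributes the value `0`. -/
def maximalFunction {n : ℕ} {Ω : Set (EuclideanSpace ℝ (Fin n))} {𝕜 : Type*} [RCLike 𝕜]
    (μ : Measure Ω) (f : Ω → 𝕜) (x : Ω) : ℝ≥0∞ :=
  ⨆ (r : ℝ) (_ : 0 < r), (∫⁻ y in Metric.ball x r, ‖f y‖ₑ ∂μ) / μ (Metric.ball x r)

end

end VariableLorentz

/-! The norm sees a function only through its rearrangement, so the theorem splits into a geometric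
and a one-dimensional half.

Geometric half: Besicovitch's covering theorem gives weak type (1,1) for the centred maximal
operator and any Borel measure (`exists_weakType_centredMaximal`). Writing |f| ≤ a + (|f| - a)₊ with
a = f^*(t) then yields (Mf)^*(t) ≤ C t⁻¹ ∫₀ᵗ f^* (`exists_rearrangement_centredMaximal_le`).

One-dimensional half: Hardy's inequality with weight t^(γ + 1/p - 1/q) in L^{q(·)}, for
non-increasing φ. It is known for constant exponents (`exists_lintegral_hardyAverage_le`), and
gluing at t = 1 gives exponents with one value near 0 and another near ∞
(`exists_modular_hardyAverage_le_twoPiece`). Log-decay reduces the general case to this one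
(`exists_modular_hardyAverage_le`): a non-increasing φ of modular at most 1 is at most polynomial in
t and 1/t, and so is its average. On values of that size a change of exponent of order 1/|log t|
costs a constant factor and an integrable error. The Hardy condition a < 1 - 1/q for a = γ + 1/p -
1/q, at 0 and at ∞, is exactly γ < 1 - 1/p. -/

namespace VariableLorentz

/-! ### Centred maximal function: measurability and weak type (1,1) -/

section Maximal

/-- The Besicovitch covering property is inherited by subspaces. -/
theorem hasBesicovitchCovering_subtype {α : Type*} [MetricSpace α] [HasBesicovitchCovering α]
    (s : Set α) : HasBesicovitchCovering s := by
  obtain ⟨N, τ, hτ, hN⟩ := HasBesicovitchCovering.no_satelliteConfig (α := α)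
  exact ⟨N, τ, hτ, ⟨fun a => hN.false
    { c := fun i => (a.c i : α), r := a.r, rpos := a.rpos, h := a.h, hlast := a.hlast,
      inter := a.inter }⟩⟩

/-- A ball of measure 0 or ∞ has quotient 0 in `ℝ≥0∞`, so a strict lower bound already forces the
measure to be positive and finite. -/
theorem mul_lt_of_lt_average {X : Type*} [MeasurableSpace X] (μ : Measure X) (g : X → ℝ≥0∞)
    {B : Set X} {s : ℝ≥0∞}
    (h : s < (∫⁻ y in B, g y ∂μ) / μ B) : s * μ B < ∫⁻ y in B, g y ∂μ := by
  have h0 : μ B ≠ 0 := by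
    intro h0
    rw [setLIntegral_measure_zero _ _ h0] at h
    simp at h
  have ht : μ B ≠ ∞ := by
    intro h0
    rw [h0] at h
    simp at h
  exact (ENNReal.lt_div_iff_mul_lt (Or.inl h0) (Or.inl ht)).1 h

variable {X : Type*} [MetricSpace X] [MeasurableSpace X]

/-- The centred maximal function of a function with values in `[0, ∞]`. -/
noncomputable def centredMaximal (μ : Measure X) (g : X → ℝ≥0∞) (x : X) : ℝ≥0∞ :=
  ⨆ (r : ℝ) (_ : 0 < r), (∫⁻ y in Metric.ball x r, g y ∂μ) / μ (Metric.ball x r)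

/-- An open ball is the increasing union of its smaller concentric balls. The room gained in the
radius serves for moving the centre, choosing a rational radius, and passing to closed balls; g need
not be measurable. -/
theorem exists_lt_radius_of_lt_setLIntegral_ball (μ : Measure X) (g : X → ℝ≥0∞) {x : X} {r : ℝ}
    {a : ℝ≥0∞} (h : a < ∫⁻ y in Metric.ball x r, g y ∂μ) :
    ∃ r', 0 < r' ∧ r' < r ∧ a < ∫⁻ y in Metric.ball x r', g y ∂μ := by
  obtain ⟨u, hu, hur, hlim⟩ := exists_seq_strictMono_tendsto r
  have hU : Metric.ball x r = ⋃ n, Metric.ball x (u n) := by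
    ext y
    simp only [Metric.mem_ball, mem_iUnion]
    constructor
    · intro hy
      exact ((hlim.eventually (lt_mem_nhds hy))).exists
    · rintro ⟨n, hn⟩
      exact hn.trans (hur n)
  have hmono : Monotone fun n => Metric.ball x (u n) := fun m n hmn =>
    Metric.ball_subset_ball (hu.monotone hmn)
  rw [hU, setLIntegral_iUnion_of_directed _ hmono.directed_le, lt_iSup_iff] at h
  obtain ⟨n, hn⟩ := h
  refine ⟨u n, ?_, hur n, hn⟩
  by_contra hneg
  rw [Metric.ball_eq_empty.2 (not_lt.1 hneg)] at hn
  simp at hn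

theorem lowerSemicontinuous_setLIntegral_ball (μ : Measure X) (g : X → ℝ≥0∞) (r : ℝ) :
    LowerSemicontinuous fun x => ∫⁻ y in Metric.ball x r, g y ∂μ := by
  intro x a ha
  obtain ⟨r', -, hr', h⟩ := exists_lt_radius_of_lt_setLIntegral_ball μ g ha
  filter_upwards [Metric.ball_mem_nhds x (sub_pos.2 hr')] with x' hx'
  refine h.trans_le (lintegral_mono_set (Metric.ball_subset_ball' ?_))
  rw [Metric.mem_ball, dist_comm] at hx'
  linarith

/-- Shrinking the radius slightly keeps the numerator large and can only lower the denominator. A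
countable supremum is what measurability requires. -/
theorem centredMaximal_eq_iSup_rat (μ : Measure X) (g : X → ℝ≥0∞) (x : X) :
    centredMaximal μ g x = ⨆ (r : ℚ) (_ : 0 < r),
      (∫⁻ y in Metric.ball x (r : ℝ), g y ∂μ) / μ (Metric.ball x (r : ℝ)) := by
  apply le_antisymm
  · refine iSup₂_le fun r hr => le_of_forall_lt fun s hs => ?_
    have ht : μ (Metric.ball x r) ≠ ∞ := by
      intro h0
      rw [h0] at hs
      simp at hs
    obtain ⟨r', h0, hr', h⟩ :=
      exists_lt_radius_of_lt_setLIntegral_ball μ g (mul_lt_of_lt_average μ g hs)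
    obtain ⟨c, hc, hcr⟩ := exists_rat_btwn hr'
    have h1 : s * μ (Metric.ball x (c : ℝ)) < ∫⁻ y in Metric.ball x (c : ℝ), g y ∂μ :=
      calc s * μ (Metric.ball x (c : ℝ)) ≤ s * μ (Metric.ball x r) := by
            gcongr
        _ < _ := h
        _ ≤ _ := lintegral_mono_set (Metric.ball_subset_ball hc.le)
    have h2 : μ (Metric.ball x (c : ℝ)) ≠ ∞ :=
      ne_top_of_le_ne_top ht (measure_mono (Metric.ball_subset_ball hcr.le))
    have h3 : μ (Metric.ball x (c : ℝ)) ≠ 0 := by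
      intro h3
      rw [setLIntegral_measure_zero _ _ h3] at h1
      simp at h1
    refine ((ENNReal.lt_div_iff_mul_lt (Or.inl h3) (Or.inl h2)).2 h1).trans_le ?_
    exact le_iSup₂_of_le c (by exact_mod_cast h0.trans hc) le_rfl
  · exact iSup₂_le fun r hr => le_iSup₂_of_le (r : ℝ) (by exact_mod_cast hr) le_rfl

theorem measurable_centredMaximal [BorelSpace X] (μ : Measure X) (g : X → ℝ≥0∞) :
    Measurable (centredMaximal μ g) := by
  have h : centredMaximal μ g = fun x => ⨆ (r : ℚ) (_ : 0 < r),
      (∫⁻ y in Metric.ball x (r : ℝ), g y ∂μ) / μ (Metric.ball x (r : ℝ)) :=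
    funext (centredMaximal_eq_iSup_rat μ g)
  rw [h]
  refine Measurable.iSup fun r => Measurable.iSup fun _ => Measurable.div ?_ ?_
  · exact (lowerSemicontinuous_setLIntegral_ball μ g r).measurable
  · simpa using (lowerSemicontinuous_setLIntegral_ball μ 1 r).measurable

/-- The weak type `(1, 1)` estimate for the centred maximal function, for arbitrary Borel
measures. -/
theorem exists_weakType_centredMaximal (X : Type*) [MetricSpace X] [MeasurableSpace X]
    [BorelSpace X] [SecondCountableTopology X] [HasBesicovitchCovering X] :
    ∃ N : ℕ, ∀ (μ : Measure X) (g : X → ℝ≥0∞) (s : ℝ≥0∞),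
      s * μ {x | s < centredMaximal μ g x} ≤ N * ∫⁻ y, g y ∂μ := by
  obtain ⟨N, τ, hτ, hN⟩ := HasBesicovitchCovering.no_satelliteConfig (α := X)
  refine ⟨N, fun μ g s => ?_⟩
  -- Besicovitch's theorem needs bounded radii, hence the cut-off k. The bound obtained does not
  -- depend on k, and the sets increase to a superset of the level set.
  let A : ℕ → Set X := fun k => {x | ∃ r : ℝ, 0 < r ∧ r ≤ k ∧
    s * μ (Metric.closedBall x r) ≤ ∫⁻ y in Metric.closedBall x r, g y ∂μ}
  have hA : Monotone A := by
    rintro k l hkl x ⟨r, hr, hrk, h⟩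
    exact ⟨r, hr, hrk.trans (by exact_mod_cast hkl), h⟩
  have hsub : {x | s < centredMaximal μ g x} ⊆ ⋃ k, A k := by
    intro x hx
    simp only [mem_ofPred_eq, centredMaximal, lt_iSup_iff] at hx
    obtain ⟨r, hr, hs⟩ := hx
    obtain ⟨r', h0, hr', h⟩ :=
      exists_lt_radius_of_lt_setLIntegral_ball μ g (mul_lt_of_lt_average μ g hs)
    obtain ⟨k, hk⟩ := exists_nat_ge r'
    refine mem_iUnion.2 ⟨k, r', h0, hk, ?_⟩
    calc s * μ (Metric.closedBall x r') ≤ s * μ (Metric.ball x r) := by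
          gcongr
          exact Metric.closedBall_subset_ball hr'
      _ ≤ _ := h.le
      _ ≤ _ := lintegral_mono_set Metric.ball_subset_closedBall
  have key : ∀ k, s * μ (A k) ≤ N * ∫⁻ y, g y ∂μ := by
    intro k
    choose! ρ hρ0 hρk hρ using fun x (hx : x ∈ A k) => hx
    let P : Besicovitch.BallPackage (A k) X :=
      { c := fun x => x, r := fun x => ρ x, rpos := fun x => hρ0 x x.2, r_bound := k,
        r_le := fun x => hρk x x.2 }
    obtain ⟨F, hF, hcov⟩ := Besicovitch.exist_disjoint_covering_families hτ hN P
    have hcount : ∀ i, (F i).Countable := fun i =>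
      (hF i).countable_of_nonempty_interior fun j _ =>
        ⟨P.c j, Metric.ball_subset_interior_closedBall (Metric.mem_ball_self (P.rpos j))⟩
    have hcov' : A k ⊆ ⋃ i : Fin N, ⋃ j ∈ F i, Metric.closedBall (P.c j) (P.r j) := by
      intro x hx
      have := hcov ⟨⟨x, hx⟩, rfl⟩
      simp only [mem_iUnion] at this ⊢
      obtain ⟨i, j, hj, h⟩ := this
      exact ⟨i, j, hj, Metric.ball_subset_closedBall h⟩
    calc s * μ (A k) ≤ s * ∑ i : Fin N, μ (⋃ j ∈ F i, Metric.closedBall (P.c j) (P.r j)) := by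
          gcongr
          exact (measure_mono hcov').trans (measure_iUnion_fintype_le _ _)
      _ = ∑ i : Fin N, s * μ (⋃ j ∈ F i, Metric.closedBall (P.c j) (P.r j)) := Finset.mul_sum _ _ _
      _ ≤ ∑ i : Fin N, ∫⁻ y, g y ∂μ := by
          refine Finset.sum_le_sum fun i _ => ?_
          calc s * μ (⋃ j ∈ F i, Metric.closedBall (P.c j) (P.r j))
              ≤ s * ∑' j : F i, μ (Metric.closedBall (P.c j) (P.r j)) := by
                gcongr
                exact measure_biUnion_le μ (hcount i) _
            _ = ∑' j : F i, s * μ (Metric.closedBall (P.c j) (P.r j)) := ENNReal.tsum_mul_left.symm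
            _ ≤ ∑' j : F i, ∫⁻ y in Metric.closedBall (P.c j) (P.r j), g y ∂μ :=
                ENNReal.tsum_le_tsum fun j => hρ _ (j : A k).2
            _ = ∫⁻ y in ⋃ j ∈ F i, Metric.closedBall (P.c j) (P.r j), g y ∂μ :=
                (lintegral_biUnion (hcount i) (fun j _ => measurableSet_closedBall) (hF i) g).symm
            _ ≤ _ := setLIntegral_le_lintegral _ _
      _ = N * ∫⁻ y, g y ∂μ := by simp
  calc s * μ {x | s < centredMaximal μ g x} ≤ s * μ (⋃ k, A k) := by gcongr
    _ = ⨆ k, s * μ (A k) := by rw [hA.measure_iUnion, ENNReal.mul_iSup]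
    _ ≤ _ := iSup_le key

end Maximal

/-! ### Rearrangements and the pointwise bound for the maximal function -/

section Rearrangement

variable {X E : Type*} [MeasurableSpace X]

theorem rearrangement_antitone [ENorm E] (μ : Measure X) (f : X → E) :
    Antitone (rearrangement μ f) := fun _ _ hst =>
  sSup_le_sSup fun _ hs => (ENNReal.ofReal_le_ofReal hst).trans_lt hs

theorem measure_le_of_rearrangement_lt [ENorm E] (μ : Measure X) (f : X → E) {t : ℝ} {s : ℝ≥0∞}
    (h : rearrangement μ f t < s) : μ {x | s < ‖f x‖ₑ} ≤ ENNReal.ofReal t := by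
  by_contra hlt
  exact (le_sSup (show s ∈ {s | ENNReal.ofReal t < μ {x | s < ‖f x‖ₑ}} from not_le.1 hlt)).not_gt h

theorem rearrangement_eq_zero [ENorm E] (μ : Measure X) (f : X → E) {t : ℝ}
    (h : μ univ ≤ ENNReal.ofReal t) : rearrangement μ f t = 0 := by
  refine (sSup_eq_bot.2 fun s hs => ?_ : rearrangement μ f t = ⊥)
  exact absurd ((h.trans_lt hs).trans_le (measure_mono (subset_univ _))) (lt_irrefl _)

/-- Layer cake: the left side is ∫₀^∞ D(s) ds with D(s) = μ{|f| > a + s} ≤ t, so D(s) is at most the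
length of {u ∈ (0,t) : u < D(s)}. After Tonelli, for fixed u the admissible s lie in (0, f^*(u)].
Tonelli is applied to two Lebesgue variables only, so μ need not be σ-finite. -/
theorem lintegral_enorm_sub_rearrangement_le [NormedAddCommGroup E] (μ : Measure X) {f : X → E}
    (hf : AEStronglyMeasurable f μ) {t : ℝ} (ha : rearrangement μ f t ≠ ∞) :
    ∫⁻ x, (‖f x‖ₑ - rearrangement μ f t) ∂μ ≤ ∫⁻ u in Ioo 0 t, rearrangement μ f u := by
  set a := rearrangement μ f t
  let D : ℝ → ℝ≥0∞ := fun s => μ {x | a + ENNReal.ofReal s < ‖f x‖ₑ}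
  have hD : Antitone D := fun s s' h => measure_mono fun x hx =>
    lt_of_le_of_lt (add_le_add_right (ENNReal.ofReal_le_ofReal h) a) hx
  have hDt : ∀ s ∈ Ioi (0 : ℝ), D s ≤ ENNReal.ofReal t := fun s hs =>
    measure_le_of_rearrangement_lt μ f (ENNReal.lt_add_right ha (by simpa using hs))
  have h1 : ∫⁻ x, (‖f x‖ₑ - a) ∂μ = ∫⁻ s in Ioi (0 : ℝ), μ {x | s < (‖f x‖ₑ - a).toReal} := by
    rw [← lintegral_eq_lintegral_meas_lt μ (Eventually.of_forall fun x => ENNReal.toReal_nonneg)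
      ((hf.enorm.sub_const a).ennreal_toReal)]
    refine lintegral_congr fun x => (ENNReal.ofReal_toReal ?_).symm
    exact ne_top_of_le_ne_top enorm_ne_top tsub_le_self
  have h2 : ∀ s ∈ Ioi (0 : ℝ), μ {x | s < (‖f x‖ₑ - a).toReal} ≤
      ∫⁻ u in Ioo 0 t, {u | ENNReal.ofReal u < D s}.indicator 1 u := by
    intro s hs
    have hfin : D s ≠ ∞ := ne_top_of_le_ne_top ENNReal.ofReal_ne_top (hDt s hs)
    have : μ {x | s < (‖f x‖ₑ - a).toReal} ≤ D s := by
      refine measure_mono fun x hx => ?_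
      have hx' : ENNReal.ofReal s < ‖f x‖ₑ - a :=
        (ENNReal.ofReal_lt_iff_lt_toReal (le_of_lt hs)
          (ne_top_of_le_ne_top enorm_ne_top tsub_le_self)).2 hx
      exact lt_tsub_iff_left.1 hx'
    refine this.trans ?_
    have hm : MeasurableSet {u : ℝ | ENNReal.ofReal u < D s} :=
      measurableSet_lt ENNReal.measurable_ofReal measurable_const
    rw [lintegral_indicator_one hm, Measure.restrict_apply hm]
    have hsub : Ioo 0 (D s).toReal ⊆ {u : ℝ | ENNReal.ofReal u < D s} ∩ Ioo 0 t := by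
      rintro u ⟨hu0, hu⟩
      have : ENNReal.ofReal u < D s := (ENNReal.ofReal_lt_iff_lt_toReal hu0.le hfin).2 hu
      exact ⟨this, hu0, (ENNReal.ofReal_lt_ofReal_iff_of_nonneg hu0.le).1
        (this.trans_le (hDt s hs))⟩
    refine le_trans ?_ (measure_mono hsub)
    rw [Real.volume_Ioo, sub_zero, ENNReal.ofReal_toReal hfin]
  have h3 : ∀ u, ∫⁻ s in Ioi (0 : ℝ), {u | ENNReal.ofReal u < D s}.indicator 1 u ≤
      rearrangement μ f u := by
    intro u
    by_cases hF : rearrangement μ f u = ∞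
    · simp [hF]
    have hm : MeasurableSet {s : ℝ | ENNReal.ofReal u < D s} :=
      measurableSet_lt measurable_const hD.measurable
    have : ∀ s, {u | ENNReal.ofReal u < D s}.indicator (1 : ℝ → ℝ≥0∞) u =
      {s | ENNReal.ofReal u < D s}.indicator 1 s := fun s => rfl
    simp only [this]
    rw [lintegral_indicator_one hm, Measure.restrict_apply hm]
    have hsub : {s : ℝ | ENNReal.ofReal u < D s} ∩ Ioi 0 ⊆
        Ioc 0 (rearrangement μ f u).toReal := by
      rintro s ⟨hs, hs0⟩
      refine ⟨hs0, ?_⟩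
      rw [← ENNReal.ofReal_le_iff_le_toReal hF]
      exact le_trans le_add_self (le_sSup hs)
    refine (measure_mono hsub).trans ?_
    rw [Real.volume_Ioc, sub_zero, ENNReal.ofReal_toReal hF]
  have hmeas : Measurable (Function.uncurry fun s u : ℝ =>
      {u | ENNReal.ofReal u < D s}.indicator (1 : ℝ → ℝ≥0∞) u) := by
    have hS : MeasurableSet {z : ℝ × ℝ | ENNReal.ofReal z.2 < D z.1} :=
      measurableSet_lt (ENNReal.measurable_ofReal.comp measurable_snd)
        (hD.measurable.comp measurable_fst)
    exact (measurable_one.indicator hS : Measurable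
      ({z : ℝ × ℝ | ENNReal.ofReal z.2 < D z.1}.indicator (1 : ℝ × ℝ → ℝ≥0∞)))
  calc ∫⁻ x, (‖f x‖ₑ - a) ∂μ
      ≤ ∫⁻ s in Ioi (0 : ℝ), ∫⁻ u in Ioo 0 t, {u | ENNReal.ofReal u < D s}.indicator 1 u := by
        rw [h1]; exact setLIntegral_mono' measurableSet_Ioi h2
    _ = ∫⁻ u in Ioo 0 t, ∫⁻ s in Ioi (0 : ℝ), {u | ENNReal.ofReal u < D s}.indicator 1 u :=
        lintegral_lintegral_swap hmeas.aemeasurable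
    _ ≤ _ := lintegral_mono h3

theorem rearrangement_mul_le_lintegral [ENorm E] (μ : Measure X) (f : X → E) (t : ℝ) :
    rearrangement μ f t * ENNReal.ofReal t ≤ ∫⁻ u in Ioo 0 t, rearrangement μ f u := by
  have h : ∫⁻ _ in Ioo 0 t, rearrangement μ f t = rearrangement μ f t * ENNReal.ofReal t := by
    simp
  rw [← h]
  exact setLIntegral_mono' measurableSet_Ioo fun u hu => rearrangement_antitone μ f hu.2.le

/-- The pointwise estimate `(M f)^*(t) ≤ C t⁻¹ ∫₀ᵗ f^*`. -/
theorem exists_rearrangement_centredMaximal_le (X : Type*) [MetricSpace X] [MeasurableSpace X]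
    [BorelSpace X] [SecondCountableTopology X] [HasBesicovitchCovering X] :
    ∃ N : ℕ, ∀ {E : Type*} [NormedAddCommGroup E] (μ : Measure X) (f : X → E),
      AEStronglyMeasurable f μ → ∀ t : ℝ, 0 < t →
        rearrangement μ (centredMaximal μ fun x => ‖f x‖ₑ) t ≤
          N * ((∫⁻ u in Ioo 0 t, rearrangement μ f u) / ENNReal.ofReal t) := by
  obtain ⟨N, hN⟩ := exists_weakType_centredMaximal X
  refine ⟨N + 1, fun {E} _ μ f hf t ht => ?_⟩
  set a := rearrangement μ f t
  set J := ∫⁻ u in Ioo 0 t, rearrangement μ f u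
  have ht0 : ENNReal.ofReal t ≠ 0 := by simpa using ht
  have haJ : a ≤ J / ENNReal.ofReal t := by
    rw [ENNReal.le_div_iff_mul_le (Or.inl ht0) (Or.inl ENNReal.ofReal_ne_top)]
    exact rearrangement_mul_le_lintegral μ f t
  by_cases ha : a = ∞
  · have : J / ENNReal.ofReal t = ∞ := top_le_iff.1 (ha ▸ haJ)
    rw [this]
    simp
  have hJ1 : ∫⁻ x, (‖f x‖ₑ - a) ∂μ ≤ J := lintegral_enorm_sub_rearrangement_le μ hf ha
  -- The average of the constant a is at most a, so {Mf > s} lies in {M(|f| - a)₊ > s - a}, where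
  -- the weak type bound applies.
  have hM : ∀ x, centredMaximal μ (fun x => ‖f x‖ₑ) x ≤
      a + centredMaximal μ (fun x => ‖f x‖ₑ - a) x := by
    intro x
    refine iSup₂_le fun r hr => ?_
    calc (∫⁻ y in Metric.ball x r, ‖f y‖ₑ ∂μ) / μ (Metric.ball x r)
        ≤ (∫⁻ y in Metric.ball x r, (a + (‖f y‖ₑ - a)) ∂μ) / μ (Metric.ball x r) := by
          gcongr
          exact le_add_tsub
      _ = a * μ (Metric.ball x r) / μ (Metric.ball x r) +
          (∫⁻ y in Metric.ball x r, (‖f y‖ₑ - a) ∂μ) / μ (Metric.ball x r) := by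
          rw [lintegral_add_left measurable_const, setLIntegral_const, ENNReal.add_div]
      _ ≤ a + centredMaximal μ (fun x => ‖f x‖ₑ - a) x := by
          gcongr
          · exact ENNReal.div_le_of_le_mul le_rfl
          · exact le_iSup₂_of_le (f := fun (r : ℝ) (_ : 0 < r) =>
              (∫⁻ y in Metric.ball x r, (‖f y‖ₑ - a) ∂μ) / μ (Metric.ball x r)) r hr le_rfl
  have hmain : rearrangement μ (centredMaximal μ fun x => ‖f x‖ₑ) t ≤
      a + N * (J / ENNReal.ofReal t) := by
    refine sSup_le fun s hs => ?_
    simp only [mem_ofPred_eq, enorm_eq_self] at hs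
    rcases le_or_gt s a with hsa | hsa
    · exact hsa.trans le_self_add
    have hsub : {x | s < centredMaximal μ (fun x => ‖f x‖ₑ) x} ⊆
        {x | s - a < centredMaximal μ (fun x => ‖f x‖ₑ - a) x} := fun x hx => by
      refine ENNReal.sub_lt_of_lt_add hsa.le ?_
      rw [add_comm]
      exact lt_of_lt_of_le hx (hM x)
    have h1 : (s - a) * ENNReal.ofReal t ≤ N * J :=
      calc (s - a) * ENNReal.ofReal t
          ≤ (s - a) * μ {x | s - a < centredMaximal μ (fun x => ‖f x‖ₑ - a) x} := by
            gcongr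
            exact hs.le.trans (measure_mono hsub)
        _ ≤ N * ∫⁻ x, (‖f x‖ₑ - a) ∂μ := hN _ _ _
        _ ≤ N * J := by gcongr
    have h2 : s - a ≤ N * (J / ENNReal.ofReal t) := by
      rw [← mul_div_assoc, ENNReal.le_div_iff_mul_le (Or.inl ht0) (Or.inl ENNReal.ofReal_ne_top)]
      exact h1
    exact tsub_le_iff_left.1 h2
  calc _ ≤ a + N * (J / ENNReal.ofReal t) := hmain
    _ ≤ J / ENNReal.ofReal t + N * (J / ENNReal.ofReal t) := by gcongr
    _ = _ := by push_cast; ring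

end Rearrangement

/-! ### Hardy's inequality with a constant exponent -/

section ConstantExponent

theorem lintegral_Ioo_rpow {s t : ℝ} (hs : -1 < s) (ht : 0 < t) :
    ∫⁻ u in Ioo 0 t, ENNReal.ofReal (u ^ s) = ENNReal.ofReal (t ^ (s + 1) / (s + 1)) := by
  have hi : IntegrableOn (fun u : ℝ => u ^ s) (Ioc 0 t) :=
    (intervalIntegrable_iff_integrableOn_Ioc_of_le ht.le).1
      (intervalIntegral.intervalIntegrable_rpow' hs)
  rw [restrict_Ioo_eq_restrict_Ioc, ← ofReal_integral_eq_lintegral_ofReal hi,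
    ← intervalIntegral.integral_of_le ht.le, integral_rpow (Or.inl hs),
    Real.zero_rpow (by linarith), sub_zero]
  filter_upwards [ae_restrict_mem measurableSet_Ioc] with u hu
  exact Real.rpow_nonneg hu.1.le s

theorem lintegral_Ioi_rpow {s c : ℝ} (hs : s < -1) (hc : 0 < c) :
    ∫⁻ u in Ioi c, ENNReal.ofReal (u ^ s) = ENNReal.ofReal (c ^ (s + 1) / -(s + 1)) := by
  rw [← ofReal_integral_eq_lintegral_ofReal (integrableOn_Ioi_rpow_of_lt hs hc),
    integral_Ioi_rpow_of_lt hs hc, div_neg, neg_div]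
  filter_upwards [ae_restrict_mem measurableSet_Ioi] with u hu
  exact Real.rpow_nonneg (hc.trans hu).le s

/-- Hölder for g = (u^b g) · u^(-b); with r conjugate to q, u^(-br) is integrable at 0 exactly when
b < 1/r = 1 - 1/q. -/
theorem exists_lintegral_le_weighted_norm {q b : ℝ} (hq : 1 < q) (hb : b < 1 - 1 / q) :
    ∃ C : ℝ≥0, ∀ g : ℝ → ℝ≥0∞, Measurable g → ∀ t : ℝ, 0 < t →
      ∫⁻ u in Ioo 0 t, g u ≤ C * ENNReal.ofReal (t ^ (1 - 1 / q - b)) *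
        (∫⁻ u in Ioo 0 t, (ENNReal.ofReal (u ^ b) * g u) ^ q) ^ (1 / q) := by
  have hc : q.HolderConjugate q.conjExponent := Real.HolderConjugate.conjExponent hq
  set r := q.conjExponent
  have hr0 : 0 < r := hc.symm.pos
  have hr : 1 / r = 1 - 1 / q := by
    have := hc.inv_add_inv_eq_one
    rw [one_div, one_div]
    linarith
  have hbr : 0 < 1 - b * r := by
    rw [← hr, lt_div_iff₀ hr0] at hb
    linarith
  refine ⟨((1 / (1 - b * r)) ^ (1 / r)).toNNReal, fun g hg t ht => ?_⟩
  have hw : ∫⁻ u in Ioo 0 t, ENNReal.ofReal (u ^ (-b)) ^ r =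
      ENNReal.ofReal (t ^ (1 - b * r) * (1 / (1 - b * r))) := by
    have h1 : ∫⁻ u in Ioo 0 t, ENNReal.ofReal (u ^ (-b)) ^ r =
        ∫⁻ u in Ioo 0 t, ENNReal.ofReal (u ^ (-(b * r))) := by
      refine setLIntegral_congr_fun measurableSet_Ioo fun u hu => ?_
      rw [ENNReal.ofReal_rpow_of_pos (Real.rpow_pos_of_pos hu.1 _), ← Real.rpow_mul hu.1.le,
        neg_mul]
    rw [h1, lintegral_Ioo_rpow (by linarith) ht, neg_add_eq_sub, mul_one_div]
  have hg' : ∫⁻ u in Ioo 0 t, g u =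
      ∫⁻ u in Ioo 0 t, ((fun u => ENNReal.ofReal (u ^ b) * g u) *
        fun u => ENNReal.ofReal (u ^ (-b))) u := by
    refine setLIntegral_congr_fun measurableSet_Ioo fun u hu => ?_
    simp only [Pi.mul_apply]
    rw [mul_right_comm, ← ENNReal.ofReal_mul (Real.rpow_nonneg hu.1.le _),
      ← Real.rpow_add hu.1, add_neg_cancel, Real.rpow_zero, ENNReal.ofReal_one, one_mul]
  rw [hg']
  refine (ENNReal.lintegral_mul_le_Lp_mul_Lq _ hc (Measurable.aemeasurable ?_)
    (Measurable.aemeasurable ?_)).trans (le_of_eq ?_)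
  · exact (ENNReal.measurable_ofReal.comp (measurable_id.pow_const b)).mul hg
  · exact ENNReal.measurable_ofReal.comp (measurable_id.pow_const (-b))
  rw [hw, mul_comm, ENNReal.ofReal_rpow_of_pos (by positivity),
    Real.mul_rpow (by positivity) (by positivity), ← Real.rpow_mul ht.le,
    ENNReal.ofReal_mul (by positivity), mul_comm (ENNReal.ofReal (t ^ _)), ← hr]
  congr 3
  congr 1
  field_simp

/-- The average `t⁻¹ ∫₀ᵗ φ`. -/
noncomputable def hardyAverage (φ : ℝ → ℝ≥0∞) (t : ℝ) : ℝ≥0∞ :=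
  (∫⁻ u in Ioo 0 t, φ u) / ENNReal.ofReal t

/-- Hardy's inequality with a power weight, for a constant exponent. -/
theorem exists_lintegral_hardyAverage_le {q a : ℝ} (hq : 1 < q) (ha : a < 1 - 1 / q) :
    ∃ C : ℝ≥0, ∀ g : ℝ → ℝ≥0∞, Measurable g →
      ∫⁻ t in Ioi 0, (ENNReal.ofReal (t ^ a) * hardyAverage g t) ^ q ≤
        C * ∫⁻ u in Ioi 0, (ENNReal.ofReal (u ^ a) * g u) ^ q := by
  -- Hölder with the larger power b leaves, after Tonelli, ∫_u^∞ t^((a-b)q-1) dt. It converges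
  -- because b > a, and its factor u^((a-b)q) turns the weight u^b back into u^a.
  obtain ⟨b, hab, hb⟩ := exists_between ha
  obtain ⟨C, hC⟩ := exists_lintegral_le_weighted_norm hq hb
  have hq0 : 0 < q := by linarith
  have he : 0 < (b - a) * q := mul_pos (by linarith) hq0
  refine ⟨C ^ q * (1 / ((b - a) * q)).toNNReal, fun g hg => ?_⟩
  let G : ℝ → ℝ≥0∞ := fun u => (ENNReal.ofReal (u ^ b) * g u) ^ q
  have hG : Measurable G :=
    ((ENNReal.measurable_ofReal.comp (measurable_id.pow_const b)).mul hg).pow_const q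
  let e : ℝ := (a - b) * q - 1
  let W : ℝ → ℝ≥0∞ := fun t => ENNReal.ofReal (t ^ e)
  have hW : Measurable W := ENNReal.measurable_ofReal.comp (measurable_id.pow_const e)
  let F : ℝ × ℝ → ℝ≥0∞ := {z : ℝ × ℝ | z.2 < z.1}.indicator fun z => W z.1 * G z.2
  have hF : Measurable F :=
    ((hW.comp measurable_fst).mul (hG.comp measurable_snd)).indicator
      (measurableSet_lt measurable_snd measurable_fst)
  have h1 : ∀ t ∈ Ioi (0 : ℝ), (ENNReal.ofReal (t ^ a) * hardyAverage g t) ^ q ≤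
      (C : ℝ≥0∞) ^ q * ∫⁻ u in Ioi 0, F (t, u) := by
    intro t ht
    have ht : 0 < t := ht
    have hFt : ∫⁻ u in Ioi 0, F (t, u) = W t * ∫⁻ u in Ioo 0 t, G u := by
      have : ∀ u, F (t, u) = (Iio t).indicator (fun u => W t * G u) u := fun u => rfl
      simp only [this]
      rw [lintegral_indicator measurableSet_Iio, Measure.restrict_restrict measurableSet_Iio,
        lintegral_const_mul _ hG, inter_comm, Ioi_inter_Iio]
    have hdiv : ENNReal.ofReal (t ^ a) * hardyAverage g t =
        ENNReal.ofReal (t ^ (a - 1)) * ∫⁻ u in Ioo 0 t, g u := by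
      rw [hardyAverage, Real.rpow_sub_one ht.ne', ENNReal.ofReal_div_of_pos ht, ← mul_div_assoc,
        ENNReal.mul_div_right_comm]
    have hexp : a - 1 + (1 - 1 / q - b) = e / q := by
      simp only [e]
      field_simp
      ring
    calc (ENNReal.ofReal (t ^ a) * hardyAverage g t) ^ q
        ≤ (ENNReal.ofReal (t ^ (a - 1)) * (C * ENNReal.ofReal (t ^ (1 - 1 / q - b)) *
            (∫⁻ u in Ioo 0 t, G u) ^ (1 / q))) ^ q := by
          rw [hdiv]
          gcongr
          exact hC g hg t ht
      _ = (C * ENNReal.ofReal (t ^ (e / q)) * (∫⁻ u in Ioo 0 t, G u) ^ (1 / q)) ^ q := by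
          rw [← hexp, Real.rpow_add ht, ENNReal.ofReal_mul (Real.rpow_nonneg ht.le _)]
          ring_nf
      _ = (C : ℝ≥0∞) ^ q * ∫⁻ u in Ioi 0, F (t, u) := by
          rw [hFt, ENNReal.mul_rpow_of_nonneg _ _ hq0.le, ENNReal.mul_rpow_of_nonneg _ _ hq0.le,
            ENNReal.ofReal_rpow_of_pos (Real.rpow_pos_of_pos ht _), ← Real.rpow_mul ht.le,
            div_mul_cancel₀ _ hq0.ne', ← ENNReal.rpow_mul, one_div_mul_cancel hq0.ne',
            ENNReal.rpow_one, mul_assoc]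
  have h2 : ∀ u ∈ Ioi (0 : ℝ), ∫⁻ t in Ioi 0, F (t, u) =
      ENNReal.ofReal (1 / ((b - a) * q)) * (ENNReal.ofReal (u ^ a) * g u) ^ q := by
    intro u hu
    have hu : 0 < u := hu
    have : ∀ t, F (t, u) = (Ioi u).indicator (fun t => W t * G u) t := fun t => rfl
    simp only [this]
    rw [lintegral_indicator measurableSet_Ioi, Measure.restrict_restrict measurableSet_Ioi,
      inter_eq_self_of_subset_left (Ioi_subset_Ioi hu.le), lintegral_mul_const _ hW,
      lintegral_Ioi_rpow (by simp only [e]; linarith) hu]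
    have : e + 1 = (a - b) * q := by simp only [e]; ring
    rw [this, show -((a - b) * q) = (b - a) * q by ring, ← mul_one_div, mul_comm (u ^ _),
      ENNReal.ofReal_mul (by positivity), mul_assoc]
    congr 1
    rw [Real.rpow_mul hu.le, ← ENNReal.ofReal_rpow_of_pos (Real.rpow_pos_of_pos hu _),
      ← ENNReal.mul_rpow_of_nonneg _ _ hq0.le, ← mul_assoc,
      ← ENNReal.ofReal_mul (Real.rpow_nonneg hu.le _), ← Real.rpow_add hu, sub_add_cancel]
  calc ∫⁻ t in Ioi 0, (ENNReal.ofReal (t ^ a) * hardyAverage g t) ^ q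
      ≤ ∫⁻ t in Ioi 0, (C : ℝ≥0∞) ^ q * ∫⁻ u in Ioi 0, F (t, u) :=
        setLIntegral_mono' measurableSet_Ioi h1
    _ = (C : ℝ≥0∞) ^ q * ∫⁻ t in Ioi 0, ∫⁻ u in Ioi 0, F (t, u) :=
        lintegral_const_mul' _ _ (ENNReal.rpow_ne_top_of_nonneg hq0.le ENNReal.coe_ne_top)
    _ = (C : ℝ≥0∞) ^ q * ∫⁻ u in Ioi 0, ∫⁻ t in Ioi 0, F (t, u) := by
        rw [lintegral_lintegral_swap (f := fun t u => F (t, u)) hF.aemeasurable]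
    _ = (C : ℝ≥0∞) ^ q * ∫⁻ u in Ioi 0,
          ENNReal.ofReal (1 / ((b - a) * q)) * (ENNReal.ofReal (u ^ a) * g u) ^ q := by
        rw [setLIntegral_congr_fun measurableSet_Ioi h2]
    _ = _ := by
        rw [lintegral_const_mul' _ _ ENNReal.ofReal_ne_top, ← mul_assoc, ENNReal.coe_mul,
          ENNReal.coe_rpow_of_nonneg _ hq0.le]
        rfl

end ConstantExponent

/-! ### Exchanging exponents at logarithmic distance -/

section Comparison

theorem rpow_le_exp_abs_mul_abs_log {t : ℝ} (ht : 0 < t) (x : ℝ) :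
    t ^ x ≤ Real.exp (|x| * |Real.log t|) := by
  rw [Real.rpow_def_of_pos ht, ← abs_mul, mul_comm]
  exact Real.exp_le_exp.2 (le_abs_self _)

theorem exp_neg_abs_mul_abs_log_le_rpow {t : ℝ} (ht : 0 < t) (x : ℝ) :
    Real.exp (-(|x| * |Real.log t|)) ≤ t ^ x := by
  rw [Real.rpow_def_of_pos ht, ← abs_mul, mul_comm]
  exact Real.exp_le_exp.2 (neg_abs_le _)

theorem rpow_le_exp_mul_rpow {t x y A : ℝ} (ht : 0 < t) (h : |x - y| * |Real.log t| ≤ A) :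
    t ^ x ≤ Real.exp A * t ^ y := by
  have : t ^ x = t ^ (x - y) * t ^ y := by rw [← Real.rpow_add ht, sub_add_cancel]
  rw [this]
  gcongr
  exact (rpow_le_exp_abs_mul_abs_log ht _).trans (Real.exp_le_exp.2 h)

/-- Exponents at logarithmic distance can be exchanged on values of at most polynomial size, up to
an integrable error. -/
theorem rpow_le_mul_rpow_add_of_log_close {K D k A l r₁ r₂ : ℝ} {ψ : ℝ≥0∞} (hl : 0 ≤ l)
    (hr₁ : 1 ≤ r₁) (hr₁K : r₁ ≤ K) (hr₂ : 1 ≤ r₂) (hr₂K : r₂ ≤ K) (hA : |r₁ - r₂| * l ≤ A)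
    (hD : 0 ≤ D) (hk : 2 ≤ k) (hψ : ψ ≤ ENNReal.ofReal (Real.exp (D + k * l))) :
    ψ ^ r₁ ≤ ENNReal.ofReal (Real.exp (K * D + k * A)) *
      (ψ ^ r₂ + ENNReal.ofReal (Real.exp (-2 * l))) := by
  have hfin : ψ ≠ ∞ := ne_top_of_le_ne_top ENNReal.ofReal_ne_top hψ
  obtain ⟨x, hx0, rfl⟩ : ∃ x : ℝ, 0 ≤ x ∧ ψ = ENNReal.ofReal x :=
    ⟨ψ.toReal, ENNReal.toReal_nonneg, (ENNReal.ofReal_toReal hfin).symm⟩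
  have hx : x ≤ Real.exp (D + k * l) := (ENNReal.ofReal_le_ofReal_iff (Real.exp_pos _).le).1 hψ
  have hA0 : 0 ≤ A := (mul_nonneg (abs_nonneg _) hl).trans hA
  have hK0 : 0 ≤ K := by linarith
  rw [ENNReal.ofReal_rpow_of_nonneg hx0 (by linarith),
    ENNReal.ofReal_rpow_of_nonneg hx0 (by linarith),
    ← ENNReal.ofReal_add (Real.rpow_nonneg hx0 _) (Real.exp_pos _).le,
    ← ENNReal.ofReal_mul (Real.exp_pos _).le]
  refine ENNReal.ofReal_le_ofReal ?_
  have hr0 : 0 ≤ x ^ r₂ := Real.rpow_nonneg hx0 _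
  -- Tiny values satisfy x^r₁ ≤ x and are absorbed by the error. Otherwise |log x| ≤ D + k l (k ≥ 2
  -- covers the lower bound), so the exponent change costs at most exp(K D + k A).
  rcases le_or_gt x (Real.exp (-2 * l)) with h | h
  · have hx1 : x ≤ 1 := h.trans (Real.exp_le_one_iff.2 (by linarith))
    calc x ^ r₁ ≤ x := by
          simpa using Real.rpow_le_rpow_of_exponent_ge_of_imp hx0 hx1 hr₁
            (fun _ _ => by linarith)
      _ ≤ 1 * (x ^ r₂ + Real.exp (-2 * l)) := by linarith
      _ ≤ _ := by
          gcongr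
          exact Real.one_le_exp (by positivity)
  · have hxpos : 0 < x := (Real.exp_pos _).trans h
    have hlog : |Real.log x| ≤ D + k * l := by
      have h1 : Real.log x ≤ D + k * l := (Real.log_le_iff_le_exp hxpos).2 hx
      have h2 : -2 * l < Real.log x := (Real.lt_log_iff_exp_lt hxpos).2 h
      have h3 : 2 * l ≤ k * l := by gcongr
      exact abs_le.2 ⟨by linarith, h1⟩
    have habs : |r₁ - r₂| ≤ K := abs_le.2 ⟨by linarith, by linarith⟩
    have hexp : |r₁ - r₂| * |Real.log x| ≤ K * D + k * A :=
      calc |r₁ - r₂| * |Real.log x| ≤ |r₁ - r₂| * (D + k * l) := by gcongr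
        _ = |r₁ - r₂| * D + k * (|r₁ - r₂| * l) := by ring
        _ ≤ K * D + k * A := by gcongr
    calc x ^ r₁ ≤ Real.exp (K * D + k * A) * x ^ r₂ := rpow_le_exp_mul_rpow hxpos hexp
      _ ≤ _ := by
          gcongr
          linarith [Real.exp_pos (-2 * l)]

theorem lintegral_exp_neg_abs_log_ne_top :
    ∫⁻ t in Ioi (0 : ℝ), ENNReal.ofReal (Real.exp (-2 * |Real.log t|)) ≠ ∞ := by
  rw [← Ioc_union_Ioi_eq_Ioi (zero_le_one' ℝ)]
  refine ne_top_of_le_ne_top ?_ (lintegral_union_le _ _ _)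
  refine ENNReal.add_ne_top.2 ⟨?_, ?_⟩
  · refine ne_top_of_le_ne_top (b := ∫⁻ _ in Ioc (0 : ℝ) 1, 1) (by simp) (lintegral_mono fun t => ?_)
    rw [← ENNReal.ofReal_one]
    exact ENNReal.ofReal_le_ofReal (Real.exp_le_one_iff.2 (by linarith [abs_nonneg (Real.log t)]))
  · have : ∫⁻ t in Ioi (1 : ℝ), ENNReal.ofReal (Real.exp (-2 * |Real.log t|)) =
        ∫⁻ t in Ioi (1 : ℝ), ENNReal.ofReal (t ^ (-2 : ℝ)) := by
      refine setLIntegral_congr_fun measurableSet_Ioi fun t ht => ?_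
      have ht : 1 < t := ht
      rw [abs_of_pos (Real.log_pos ht), Real.rpow_def_of_pos (by linarith), mul_comm]
    rw [this, lintegral_Ioi_rpow (by norm_num) one_pos]
    exact ENNReal.ofReal_ne_top

/-- A non-increasing function with modular at most one has at most polynomial size. -/
theorem Antitone.le_exp_of_lintegral_rpow_le_one {φ : ℝ → ℝ≥0∞} (hφ : Antitone φ) {q α : ℝ → ℝ}
    {A M : ℝ} (hM : 0 ≤ M)
    (h : ∀ᵐ s ∂volume.restrict (Ioi (0 : ℝ)),
      1 ≤ q s ∧ |α s| * |Real.log s| ≤ A + M * |Real.log s|)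
    (hint : ∫⁻ s in Ioi 0, (ENNReal.ofReal (s ^ α s) * φ s) ^ q s ≤ 1) {t : ℝ} (ht : 0 < t) :
    φ t ≤ ENNReal.ofReal (Real.exp (A + M + 1 + (M + 1) * |Real.log t|)) := by
  set l := |Real.log t|
  set c := Real.exp (-(A + M + M * l)) with hc
  have hc0 : 0 < c := Real.exp_pos _
  -- On (t/2, t) one has φ(s) ≥ φ(t) and s^α(s) ≥ c, since |log s| ≤ l + 1. If the bound failed, the
  -- integrand there would exceed 2 e^l (the base is ≥ 1, so the power q ≥ 1 does not lower it), and
  -- the modular would exceed e^l t ≥ 1.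
  have hy : ENNReal.ofReal c * φ t ≤ ENNReal.ofReal (2 * Real.exp l) := by
    by_contra! hlt
    have hone : 1 ≤ ENNReal.ofReal c * φ t := by
      refine le_trans ?_ hlt.le
      rw [← ENNReal.ofReal_one]
      refine ENNReal.ofReal_le_ofReal ?_
      linarith [Real.one_le_exp (abs_nonneg (Real.log t))]
    have hsub : Ioo (t / 2) t ⊆ Ioi 0 := fun s hs => lt_trans (by positivity) hs.1
    have hle : ∀ᵐ s ∂volume.restrict (Ioo (t / 2) t),
        ENNReal.ofReal c * φ t ≤ (ENNReal.ofReal (s ^ α s) * φ s) ^ q s := by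
      filter_upwards [ae_restrict_of_ae_restrict_of_subset hsub h,
        ae_restrict_mem measurableSet_Ioo] with s hs hst
      have hs0 : 0 < s := hsub hst
      have hlogs : |Real.log s| ≤ l + 1 := by
        have h1 : Real.log s ≤ Real.log t := Real.log_le_log hs0 hst.2.le
        have h2 : Real.log (t / 2) ≤ Real.log s := Real.log_le_log (by positivity) hst.1.le
        rw [Real.log_div ht.ne' two_ne_zero] at h2
        have h3 := Real.log_two_lt_d9
        exact abs_le.2 ⟨by linarith [neg_abs_le (Real.log t)], by linarith [le_abs_self (Real.log t)]⟩
      have hcs : c ≤ s ^ α s := by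
        refine le_trans (Real.exp_le_exp.2 ?_) (exp_neg_abs_mul_abs_log_le_rpow hs0 _)
        have : M * |Real.log s| ≤ M * (l + 1) := by gcongr
        linarith [hs.2]
      have hbase : ENNReal.ofReal c * φ t ≤ ENNReal.ofReal (s ^ α s) * φ s := by
        gcongr
        exact hφ hst.2.le
      calc ENNReal.ofReal c * φ t ≤ ENNReal.ofReal (s ^ α s) * φ s := hbase
        _ = (ENNReal.ofReal (s ^ α s) * φ s) ^ (1 : ℝ) := (ENNReal.rpow_one _).symm
        _ ≤ _ := ENNReal.rpow_le_rpow_of_exponent_le (hone.trans hbase) hs.1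
    have h1 : ENNReal.ofReal c * φ t * ENNReal.ofReal (t / 2) ≤ 1 :=
      calc ENNReal.ofReal c * φ t * ENNReal.ofReal (t / 2)
          = ∫⁻ _ in Ioo (t / 2) t, ENNReal.ofReal c * φ t := by
            rw [setLIntegral_const, Real.volume_Ioo, sub_half]
        _ ≤ ∫⁻ s in Ioo (t / 2) t, (ENNReal.ofReal (s ^ α s) * φ s) ^ q s := lintegral_mono_ae hle
        _ ≤ ∫⁻ s in Ioi 0, (ENNReal.ofReal (s ^ α s) * φ s) ^ q s := lintegral_mono_set hsub
        _ ≤ 1 := hint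
    have h2 : (1 : ℝ≥0∞) ≤ ENNReal.ofReal (2 * Real.exp l) * ENNReal.ofReal (t / 2) := by
      rw [← ENNReal.ofReal_mul (by positivity), ← ENNReal.ofReal_one]
      refine ENNReal.ofReal_le_ofReal ?_
      have h3 : Real.exp (-l) ≤ t := by
        rw [← Real.le_log_iff_exp_le ht]
        exact neg_abs_le _
      have h4 : Real.exp l * Real.exp (-l) = 1 := by rw [← Real.exp_add]; simp
      nlinarith [Real.exp_pos l]
    have h3 : ENNReal.ofReal (2 * Real.exp l) * ENNReal.ofReal (t / 2) <
        ENNReal.ofReal c * φ t * ENNReal.ofReal (t / 2) :=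
      (ENNReal.mul_lt_mul_iff_left (by simpa using ht) ENNReal.ofReal_ne_top).2 hlt
    exact absurd (h2.trans_lt h3) (not_lt.2 h1)
  calc φ t = ENNReal.ofReal (Real.exp (A + M + M * l)) * (ENNReal.ofReal c * φ t) := by
        rw [← mul_assoc, ← ENNReal.ofReal_mul (Real.exp_pos _).le, hc, ← Real.exp_add]
        simp
    _ ≤ ENNReal.ofReal (Real.exp (A + M + M * l)) * ENNReal.ofReal (2 * Real.exp l) := by gcongr
    _ ≤ ENNReal.ofReal (Real.exp (A + M + M * l)) *
        ENNReal.ofReal (Real.exp 1 * Real.exp l) := by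
        gcongr
        linarith [Real.add_one_le_exp (1 : ℝ)]
    _ = _ := by
        rw [← ENNReal.ofReal_mul (Real.exp_pos _).le, ← Real.exp_add, ← Real.exp_add]
        ring_nf

end Comparison

/-! ### Modular Hardy inequality: two-piece exponents, then log-decaying ones -/

section ModularHardy

/-- The function equal to `x` on `(-∞, 1]` and to `y` on `(1, ∞)`. -/
noncomputable def twoPiece (x y t : ℝ) : ℝ := if t ≤ 1 then x else y

theorem twoPiece_of_le {x y t : ℝ} (h : t ≤ 1) : twoPiece x y t = x := if_pos h

theorem twoPiece_of_lt {x y t : ℝ} (h : 1 < t) : twoPiece x y t = y := if_neg h.not_ge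

/-- Hardy's inequality in modular form, for exponents that are constant on `(0, 1]` and on
`(1, ∞)`. -/
theorem exists_modular_hardyAverage_le_twoPiece {q₀ q₁ a₀ a₁ : ℝ} (hq₀ : 1 < q₀) (hq₁ : 1 < q₁)
    (ha₀ : a₀ < 1 - 1 / q₀) (ha₁ : a₁ < 1 - 1 / q₁) (R : ℝ≥0) :
    ∃ C : ℝ≥0, ∀ φ : ℝ → ℝ≥0∞, Measurable φ →
      ∫⁻ t in Ioi 0, (ENNReal.ofReal (t ^ twoPiece a₀ a₁ t) * φ t) ^ twoPiece q₀ q₁ t ≤ R →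
        ∫⁻ t in Ioi 0,
          (ENNReal.ofReal (t ^ twoPiece a₀ a₁ t) * hardyAverage φ t) ^ twoPiece q₀ q₁ t ≤ C ∧
        ∫⁻ u in Ioo 0 1, φ u ≤ C := by
  obtain ⟨C₀, hC₀⟩ := exists_lintegral_hardyAverage_le hq₀ ha₀
  obtain ⟨C₁, hC₁⟩ := exists_lintegral_hardyAverage_le hq₁ ha₁
  obtain ⟨C₂, hC₂⟩ := exists_lintegral_le_weighted_norm hq₀ ha₀
  have hq₀' : 0 < q₀ := by linarith
  have hq₁' : 0 < q₁ := by linarith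
  -- This makes the contribution of φ on (0,1] to averages at t > 1, namely J/t, integrable at ∞
  -- with its weight.
  have htail : (a₁ - 1) * q₁ < -1 := by
    have : 1 / q₁ * q₁ = 1 := one_div_mul_cancel hq₁'.ne'
    nlinarith
  set T : ℝ≥0 := ((1 : ℝ) ^ ((a₁ - 1) * q₁ + 1) / -((a₁ - 1) * q₁ + 1)).toNNReal
  set J : ℝ≥0 := C₂ * R ^ (1 / q₀)
  set P : ℝ≥0 := C₀ * R + 2 ^ (q₁ - 1) * (J ^ q₁ * T + C₁ * R)
  refine ⟨max P J, fun φ hφ hR => ?_⟩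
  set I : ℝ → ℝ≥0∞ := fun t => (ENNReal.ofReal (t ^ twoPiece a₀ a₁ t) * φ t) ^ twoPiece q₀ q₁ t
  have hJ : ∫⁻ u in Ioo 0 1, φ u ≤ J := by
    refine (hC₂ φ hφ 1 one_pos).trans ?_
    rw [Real.one_rpow, ENNReal.ofReal_one, mul_one, ENNReal.coe_mul,
      ENNReal.coe_rpow_of_nonneg _ (by positivity)]
    gcongr
    refine le_trans ?_ hR
    refine le_trans (le_of_eq ?_) (lintegral_mono_set (Ioo_subset_Ioi_self (a := 1) (b := 0)))
    refine setLIntegral_congr_fun measurableSet_Ioo fun u hu => ?_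
    simp only [twoPiece_of_le hu.2.le]
  -- For t ≤ 1 the average sees only φ on (0,1], so truncating φ there reduces to the constant
  -- exponent q₀.
  have hnear : ∫⁻ t in Ioc 0 1,
      (ENNReal.ofReal (t ^ twoPiece a₀ a₁ t) * hardyAverage φ t) ^ twoPiece q₀ q₁ t ≤ C₀ * R := by
    calc _ = ∫⁻ t in Ioc 0 1, (ENNReal.ofReal (t ^ a₀) *
            hardyAverage ((Iic 1).indicator φ) t) ^ q₀ := by
          refine setLIntegral_congr_fun measurableSet_Ioc fun t ht => ?_
          have : hardyAverage ((Iic 1).indicator φ) t = hardyAverage φ t := by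
            rw [hardyAverage, hardyAverage]
            congr 1
            refine setLIntegral_congr_fun measurableSet_Ioo fun u hu => ?_
            exact indicator_of_mem (show u ∈ Iic (1 : ℝ) from hu.2.le.trans ht.2) _
          simp only [twoPiece_of_le ht.2, this]
      _ ≤ ∫⁻ t in Ioi 0, (ENNReal.ofReal (t ^ a₀) *
            hardyAverage ((Iic 1).indicator φ) t) ^ q₀ := lintegral_mono_set Ioc_subset_Ioi_self
      _ ≤ C₀ * ∫⁻ u in Ioi 0, (ENNReal.ofReal (u ^ a₀) * (Iic 1).indicator φ u) ^ q₀ :=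
          hC₀ _ (hφ.indicator measurableSet_Iic)
      _ ≤ C₀ * ∫⁻ u in Ioi 0, I u := by
          gcongr with u
          by_cases hu : u ≤ 1
          · rw [indicator_of_mem (show u ∈ Iic (1 : ℝ) from hu)]
            simp only [I, twoPiece_of_le hu, le_refl]
          · rw [indicator_of_notMem (show u ∉ Iic (1 : ℝ) from hu), mul_zero,
              ENNReal.zero_rpow_of_pos hq₀']
            exact zero_le
      _ ≤ C₀ * R := by gcongr
  have hfar : ∫⁻ t in Ioi 1,
      (ENNReal.ofReal (t ^ twoPiece a₀ a₁ t) * hardyAverage φ t) ^ twoPiece q₀ q₁ t ≤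
        2 ^ (q₁ - 1) * (J ^ q₁ * T + C₁ * R) := by
    have hmeas : Measurable fun t : ℝ => (J : ℝ≥0∞) ^ q₁ * ENNReal.ofReal (t ^ ((a₁ - 1) * q₁)) :=
      (ENNReal.measurable_ofReal.comp (measurable_id.pow_const _)).const_mul _
    calc _ ≤ ∫⁻ t in Ioi 1, 2 ^ (q₁ - 1) * ((J : ℝ≥0∞) ^ q₁ *
            ENNReal.ofReal (t ^ ((a₁ - 1) * q₁)) + (ENNReal.ofReal (t ^ a₁) *
            hardyAverage ((Ioi 1).indicator φ) t) ^ q₁) := by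
          refine setLIntegral_mono' measurableSet_Ioi fun t ht => ?_
          have ht : 1 < t := ht
          have ht0 : 0 < t := by linarith
          have hsplit : hardyAverage φ t ≤
              J / ENNReal.ofReal t + hardyAverage ((Ioi 1).indicator φ) t := by
            rw [hardyAverage, hardyAverage, ← ENNReal.add_div]
            gcongr
            have hset : Ioo 0 t = Ioc 0 1 ∪ Ioo 1 t := (Ioc_union_Ioo_eq_Ioo zero_le_one ht).symm
            calc ∫⁻ u in Ioo 0 t, φ u ≤ (∫⁻ u in Ioc 0 1, φ u) + ∫⁻ u in Ioo 1 t, φ u := by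
                  rw [hset]
                  exact lintegral_union_le _ _ _
              _ ≤ J + ∫⁻ u in Ioo 0 t, (Ioi 1).indicator φ u := by
                  refine add_le_add ?_ ?_
                  · rw [← restrict_Ioo_eq_restrict_Ioc]
                    exact hJ
                  · refine le_trans (le_of_eq ?_)
                      (lintegral_mono_set (Ioo_subset_Ioo_left (zero_le_one' ℝ)))
                    refine setLIntegral_congr_fun measurableSet_Ioo fun u hu => ?_
                    exact (indicator_of_mem (show u ∈ Ioi (1 : ℝ) from hu.1) _).symm
          rw [twoPiece_of_lt ht, twoPiece_of_lt ht]
          have hJt : (ENNReal.ofReal (t ^ a₁) * (J / ENNReal.ofReal t)) ^ q₁ =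
              (J : ℝ≥0∞) ^ q₁ * ENNReal.ofReal (t ^ ((a₁ - 1) * q₁)) := by
            rw [Real.rpow_mul ht0.le, ← ENNReal.ofReal_rpow_of_pos (Real.rpow_pos_of_pos ht0 _),
              ← ENNReal.mul_rpow_of_nonneg _ _ hq₁'.le, Real.rpow_sub_one ht0.ne',
              ENNReal.ofReal_div_of_pos ht0, ← mul_div_assoc, ← mul_div_assoc, mul_comm]
          calc _ ≤ (ENNReal.ofReal (t ^ a₁) * (J / ENNReal.ofReal t) + ENNReal.ofReal (t ^ a₁) *
                hardyAverage ((Ioi 1).indicator φ) t) ^ q₁ := by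
                rw [← mul_add]
                gcongr
            _ ≤ _ := by
                rw [← hJt]
                exact ENNReal.rpow_add_le_mul_rpow_add_rpow _ _ hq₁.le
      _ = 2 ^ (q₁ - 1) * ((J : ℝ≥0∞) ^ q₁ * T + ∫⁻ t in Ioi 1, (ENNReal.ofReal (t ^ a₁) *
            hardyAverage ((Ioi 1).indicator φ) t) ^ q₁) := by
          rw [lintegral_const_mul' _ _
            (ENNReal.rpow_ne_top_of_nonneg (by linarith) (by norm_num)),
            lintegral_add_left hmeas, lintegral_const_mul' _ _
            (ENNReal.rpow_ne_top_of_nonneg hq₁'.le ENNReal.coe_ne_top),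
            lintegral_Ioi_rpow htail one_pos]
          rfl
      _ ≤ 2 ^ (q₁ - 1) * ((J : ℝ≥0∞) ^ q₁ * T + C₁ * ∫⁻ u in Ioi 0, (ENNReal.ofReal (u ^ a₁) *
            (Ioi 1).indicator φ u) ^ q₁) := by
          gcongr
          exact (lintegral_mono_set (Ioi_subset_Ioi zero_le_one)).trans
            (hC₁ _ (hφ.indicator measurableSet_Ioi))
      _ ≤ 2 ^ (q₁ - 1) * ((J : ℝ≥0∞) ^ q₁ * T + C₁ * ∫⁻ u in Ioi 0, I u) := by
          gcongr with u
          by_cases hu : 1 < u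
          · rw [indicator_of_mem (show u ∈ Ioi (1 : ℝ) from hu)]
            simp only [I, twoPiece_of_lt hu, le_refl]
          · rw [indicator_of_notMem (show u ∉ Ioi (1 : ℝ) from hu), mul_zero,
              ENNReal.zero_rpow_of_pos hq₁']
            exact zero_le
      _ ≤ _ := by gcongr
  constructor
  · rw [← Ioc_union_Ioi_eq_Ioi (zero_le_one' ℝ)]
    refine (lintegral_union_le _ _ _).trans ((add_le_add hnear hfar).trans ?_)
    refine le_trans (le_of_eq ?_) (ENNReal.coe_le_coe.2 (le_max_left P J))
    simp only [P]
    push_cast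
    rw [ENNReal.coe_rpow_of_nonneg _ hq₁'.le, ENNReal.coe_rpow_of_nonneg _ (by linarith)]
    norm_num
  · exact hJ.trans (ENNReal.coe_le_coe.2 (le_max_right P J))

/-- Hardy's inequality for non-increasing functions in modular form, for exponents that are
logarithmically close to constants at `0` and at `∞`. -/
theorem exists_modular_hardyAverage_le {q α : ℝ → ℝ} {q₀ q₁ a₀ a₁ K A : ℝ}
    (hq₀ : 1 < q₀) (hq₁ : 1 < q₁) (ha₀ : a₀ < 1 - 1 / q₀) (ha₁ : a₁ < 1 - 1 / q₁)
    (hK₀ : q₀ ≤ K) (hK₁ : q₁ ≤ K)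
    (hq : ∀ᵐ t ∂volume.restrict (Ioi (0 : ℝ)), 1 ≤ q t ∧ q t ≤ K ∧
      |q t - twoPiece q₀ q₁ t| * |Real.log t| ≤ A)
    (hα : ∀ᵐ t ∂volume.restrict (Ioi (0 : ℝ)), |α t - twoPiece a₀ a₁ t| * |Real.log t| ≤ A) :
    ∃ C : ℝ≥0, ∀ φ : ℝ → ℝ≥0∞, Antitone φ →
      ∫⁻ t in Ioi 0, (ENNReal.ofReal (t ^ α t) * φ t) ^ q t ≤ 1 →
        ∫⁻ t in Ioi 0, (ENNReal.ofReal (t ^ α t) * hardyAverage φ t) ^ q t ≤ C := by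
  have hA : 0 ≤ A := by
    have : NeZero (volume.restrict (Ioi (0 : ℝ))) := ⟨by simp⟩
    obtain ⟨t, ht⟩ := hα.exists
    exact (by positivity : 0 ≤ |α t - twoPiece a₀ a₁ t| * |Real.log t|).trans ht
  set M := max |a₀| |a₁|
  have hM : 0 ≤ M := le_max_of_le_left (abs_nonneg _)
  have hMa : ∀ t, |twoPiece a₀ a₁ t| ≤ M := fun t => by
    unfold twoPiece
    split_ifs
    exacts [le_max_left _ _, le_max_right _ _]
  have hQ : ∀ t, 1 ≤ twoPiece q₀ q₁ t ∧ twoPiece q₀ q₁ t ≤ K := fun t => by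
    unfold twoPiece
    split_ifs
    exacts [⟨hq₀.le, hK₀⟩, ⟨hq₁.le, hK₁⟩]
  set D := A + M + 1
  have hD : 0 ≤ D := by positivity
  set e : ℝ → ℝ≥0∞ := fun t => ENNReal.ofReal (Real.exp (-2 * |Real.log t|))
  have hem : Measurable e :=
    ENNReal.measurable_ofReal.comp ((Real.measurable_log.abs.const_mul (-2)).exp)
  have hE := lintegral_exp_neg_abs_log_ne_top
  set E : ℝ≥0 := (∫⁻ t in Ioi (0 : ℝ), e t).toNNReal
  have hE' : ∫⁻ t in Ioi (0 : ℝ), e t = E := (ENNReal.coe_toNNReal hE).symm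
  -- Here k = 2M + 2: φ has growth exponent M + 1 and the weight adds M; the total 2M + 1 is rounded
  -- up to meet k ≥ 2.
  set c : ℝ≥0 := (Real.exp (K * D + (2 * M + 2) * A)).toNNReal
  set d : ℝ≥0 := (Real.exp A).toNNReal ^ K
  have hd : ∀ {x y : ℝ≥0∞} {r : ℝ}, 1 ≤ r → r ≤ K → x ≤ ENNReal.ofReal (Real.exp A) * y →
      x ^ r ≤ d * y ^ r := by
    intro x y r hr hrK hxy
    have h1 : (1 : ℝ≥0∞) ≤ ENNReal.ofReal (Real.exp A) := by
      rw [← ENNReal.ofReal_one]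
      exact ENNReal.ofReal_le_ofReal (Real.one_le_exp hA)
    calc x ^ r ≤ (ENNReal.ofReal (Real.exp A) * y) ^ r := by gcongr
      _ = ENNReal.ofReal (Real.exp A) ^ r * y ^ r := ENNReal.mul_rpow_of_nonneg _ _ (by linarith)
      _ ≤ ENNReal.ofReal (Real.exp A) ^ K * y ^ r := by
          gcongr
      _ = d * y ^ r := by
          rw [ENNReal.coe_rpow_of_nonneg _ (by linarith)]
          rfl
  have hweight : ∀ {x y t : ℝ} {z : ℝ≥0∞}, 0 < t → |x - y| * |Real.log t| ≤ A →
      ENNReal.ofReal (t ^ x) * z ≤ ENNReal.ofReal (Real.exp A) * (ENNReal.ofReal (t ^ y) * z) := by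
    intro x y t z ht h
    rw [← mul_assoc, ← ENNReal.ofReal_mul (Real.exp_pos _).le]
    gcongr
    exact rpow_le_exp_mul_rpow ht h
  have hsize : ∀ {t D' k : ℝ} {z : ℝ≥0∞}, 0 < t → z ≤ ENNReal.ofReal (Real.exp (D' +
      k * |Real.log t|)) → ENNReal.ofReal (t ^ twoPiece a₀ a₁ t) * z ≤
        ENNReal.ofReal (Real.exp (D' + (M + k) * |Real.log t|)) := by
    intro t D' k z ht hz
    calc _ ≤ ENNReal.ofReal (Real.exp (M * |Real.log t|)) *
          ENNReal.ofReal (Real.exp (D' + k * |Real.log t|)) := by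
          gcongr
          exact (rpow_le_exp_abs_mul_abs_log ht _).trans (Real.exp_le_exp.2 (by gcongr; exact hMa t))
      _ = _ := by
          rw [← ENNReal.ofReal_mul (Real.exp_pos _).le, ← Real.exp_add]
          ring_nf
  set R : ℝ≥0 := c * (d + E)
  obtain ⟨C, hC⟩ := exists_modular_hardyAverage_le_twoPiece hq₀ hq₁ ha₀ ha₁ R
  -- Splitting ∫₀ᵗ φ at 1, with C bounding ∫₀¹ φ and the second term bounding φ(1), gives an average
  -- of at most e^D' e^|log t|.
  set D' := Real.log (C + Real.exp (D + (M + 1) * |Real.log 1|)) with hD'_def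
  have hsum : 1 ≤ (C : ℝ) + Real.exp (D + (M + 1) * |Real.log 1|) := by
    have := Real.one_le_exp (show 0 ≤ D + (M + 1) * |Real.log 1| by positivity)
    linarith [C.coe_nonneg]
  have hD' : 0 ≤ D' := Real.log_nonneg hsum
  set c' : ℝ≥0 := (Real.exp (K * D' + (M + 2) * A)).toNNReal
  refine ⟨d * (c' * (C + E)), fun φ hφ hint => ?_⟩
  have hφD : ∀ t, 0 < t → φ t ≤ ENNReal.ofReal (Real.exp (D + (M + 1) * |Real.log t|)) := by
    intro t ht
    refine Antitone.le_exp_of_lintegral_rpow_le_one hφ hM ?_ hint ht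
    filter_upwards [hq, hα] with s hs hs'
    refine ⟨hs.1, ?_⟩
    have : |α s| ≤ |α s - twoPiece a₀ a₁ s| + M := by
      have := abs_add_le (α s - twoPiece a₀ a₁ s) (twoPiece a₀ a₁ s)
      rw [sub_add_cancel] at this
      linarith [hMa s]
    nlinarith [abs_nonneg (Real.log s)]
  have hmodel : ∫⁻ t in Ioi 0,
      (ENNReal.ofReal (t ^ twoPiece a₀ a₁ t) * φ t) ^ twoPiece q₀ q₁ t ≤ R := by
    calc _ ≤ ∫⁻ t in Ioi 0, c * (d * (ENNReal.ofReal (t ^ α t) * φ t) ^ q t + e t) := by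
          refine lintegral_mono_ae ?_
          filter_upwards [hq, hα, ae_restrict_mem measurableSet_Ioi] with t hqt hαt ht
          refine (rpow_le_mul_rpow_add_of_log_close (A := A) (abs_nonneg (Real.log t)) (hQ t).1
            (hQ t).2 hqt.1 hqt.2.1 (by rw [abs_sub_comm]; exact hqt.2.2) hD (k := 2 * M + 2)
            (by linarith) ?_).trans ?_
          · refine (hsize ht (hφD t ht)).trans (ENNReal.ofReal_le_ofReal (Real.exp_le_exp.2 ?_))
            have := abs_nonneg (Real.log t)
            nlinarith
          · refine mul_le_mul_right (add_le_add_left (hd hqt.1 hqt.2.1 ?_) _) _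
            exact hweight ht (by rw [abs_sub_comm]; exact hαt)
      _ = c * (d * (∫⁻ t in Ioi 0, (ENNReal.ofReal (t ^ α t) * φ t) ^ q t) + E) := by
          rw [lintegral_const_mul' _ _ ENNReal.coe_ne_top, lintegral_add_right _ hem,
            lintegral_const_mul' _ _ ENNReal.coe_ne_top, hE']
      _ ≤ c * (d * 1 + E) := by gcongr
      _ = R := by simp [R]
  obtain ⟨hH, hJ⟩ := hC φ hφ.measurable hmodel
  have havg : ∀ t, 0 < t →
      hardyAverage φ t ≤ ENNReal.ofReal (Real.exp (D' + 1 * |Real.log t|)) := by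
    intro t ht
    have h1 : ∫⁻ u in Ioo 0 t, φ u ≤ C + φ 1 * ENNReal.ofReal t :=
      calc ∫⁻ u in Ioo 0 t, φ u ≤ ∫⁻ u in Ioo 0 1 ∪ Ico 1 t, φ u := by
            refine lintegral_mono_set fun u hu => ?_
            rcases lt_or_ge u 1 with h | h
            exacts [Or.inl ⟨hu.1, h⟩, Or.inr ⟨h, hu.2⟩]
        _ ≤ (∫⁻ u in Ioo 0 1, φ u) + ∫⁻ u in Ico 1 t, φ u := lintegral_union_le _ _ _
        _ ≤ C + ∫⁻ _ in Ico 1 t, φ 1 :=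
            add_le_add hJ (setLIntegral_mono' measurableSet_Ico fun u hu => hφ hu.1)
        _ ≤ _ := by
            rw [setLIntegral_const, Real.volume_Ico]
            gcongr
            linarith
    have hinv : (ENNReal.ofReal t)⁻¹ ≤ ENNReal.ofReal (Real.exp |Real.log t|) := by
      rw [← ENNReal.ofReal_inv_of_pos ht]
      refine ENNReal.ofReal_le_ofReal ?_
      rw [← Real.log_le_iff_le_exp (inv_pos.2 ht), Real.log_inv]
      exact neg_le_abs _
    have hone : (1 : ℝ≥0∞) ≤ ENNReal.ofReal (Real.exp |Real.log t|) := by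
      rw [← ENNReal.ofReal_one]
      exact ENNReal.ofReal_le_ofReal (Real.one_le_exp (abs_nonneg _))
    have ht0 : ENNReal.ofReal t ≠ 0 := by simpa using ht
    calc hardyAverage φ t ≤ (C + φ 1 * ENNReal.ofReal t) / ENNReal.ofReal t :=
          ENNReal.div_le_div_right h1 _
      _ = C * (ENNReal.ofReal t)⁻¹ + φ 1 * 1 := by
          rw [ENNReal.add_div, mul_div_assoc, ENNReal.div_self ht0 ENNReal.ofReal_ne_top,
            div_eq_mul_inv]
      _ ≤ C * ENNReal.ofReal (Real.exp |Real.log t|) +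
          ENNReal.ofReal (Real.exp (D + (M + 1) * |Real.log 1|)) *
            ENNReal.ofReal (Real.exp |Real.log t|) := by
          gcongr
          exact hφD 1 one_pos
      _ = _ := by
          rw [← add_mul, ← ENNReal.ofReal_coe_nnreal,
            ← ENNReal.ofReal_add C.coe_nonneg (Real.exp_pos _).le,
            ← ENNReal.ofReal_mul (by positivity), Real.exp_add D', one_mul, hD'_def,
            Real.exp_log (by linarith)]
  calc _ ≤ ∫⁻ t in Ioi 0, d * (c' * ((ENNReal.ofReal (t ^ twoPiece a₀ a₁ t) *
        hardyAverage φ t) ^ twoPiece q₀ q₁ t + e t)) := by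
        refine lintegral_mono_ae ?_
        filter_upwards [hq, hα, ae_restrict_mem measurableSet_Ioi] with t hqt hαt ht
        refine (hd hqt.1 hqt.2.1 (hweight ht hαt)).trans (mul_le_mul_right ?_ _)
        refine rpow_le_mul_rpow_add_of_log_close (abs_nonneg (Real.log t)) hqt.1 hqt.2.1
            (hQ t).1 (hQ t).2 hqt.2.2 hD' (k := M + 2) (by linarith) ?_
        refine (hsize ht (havg t ht)).trans (ENNReal.ofReal_le_ofReal (Real.exp_le_exp.2 ?_))
        gcongr
        norm_num
    _ = d * (c' * ((∫⁻ t in Ioi 0, (ENNReal.ofReal (t ^ twoPiece a₀ a₁ t) *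
        hardyAverage φ t) ^ twoPiece q₀ q₁ t) + E)) := by
        rw [lintegral_const_mul' _ _ ENNReal.coe_ne_top,
          lintegral_const_mul' _ _ ENNReal.coe_ne_top, lintegral_add_right _ hem, hE']
    _ ≤ d * (c' * (C + E)) := by gcongr
    _ = _ := by push_cast; rfl

end ModularHardy

/-! ### From modulars to Luxemburg norms -/

section Luxemburg

theorem measurableSet_interval (ℓ : ℝ≥0∞) : MeasurableSet (interval ℓ) :=
  (measurableSet_lt measurable_const measurable_id).inter
    (measurableSet_lt ENNReal.measurable_ofReal measurable_const)

theorem eventually_mem_interval {ℓ : ℝ≥0∞} (hℓ : ℓ ≠ 0) : ∀ᶠ t in 𝓝[>] (0 : ℝ), t ∈ interval ℓ := by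
  have h : ∀ᶠ t in 𝓝 (0 : ℝ), ENNReal.ofReal t < ℓ :=
    (ENNReal.continuous_ofReal.tendsto 0).eventually
      (gt_mem_nhds (by simpa using pos_iff_ne_zero.2 hℓ))
  filter_upwards [self_mem_nhdsWithin, h.filter_mono nhdsWithin_le_nhds] with t ht h
  exact ⟨ht, h⟩

/-- For finite length the value at ∞ is free; it will be set equal to the value at 0, so that the
conditions at ∞ hold too. -/
theorem LogDecay.of_ne_top {ℓ : ℝ≥0∞} {p : ℝ → ℝ} {p₀ pInf : ℝ} (h : LogDecay ℓ p p₀ pInf)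
    (hℓ : ℓ ≠ ∞) (x : ℝ) : LogDecay ℓ p p₀ x :=
  ⟨h.memLp_top, h.tendsto_zero, h.decay_zero, fun h => absurd h hℓ, fun h => absurd h hℓ⟩

/-- Decay is used for t ≤ 1/2 and, if ℓ = ∞, for t > 1. On the remaining range log t is bounded and
essential boundedness of p suffices, hence the "almost every". -/
theorem LogDecay.exists_log_close {ℓ : ℝ≥0∞} {p : ℝ → ℝ} {p₀ pInf : ℝ}
    (h : LogDecay ℓ p p₀ pInf) : ∃ A : ℝ, ∀ᵐ t ∂volume.restrict (interval ℓ),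
      |p t - twoPiece p₀ pInf t| * |Real.log t| ≤ A := by
  set B := (eLpNormEssSup p (volume.restrict (interval ℓ))).toReal
  have hB : ∀ᵐ t ∂volume.restrict (interval ℓ), |p t| ≤ B := by
    have hfin : eLpNormEssSup p (volume.restrict (interval ℓ)) ≠ ∞ := by
      have := h.memLp_top.eLpNorm_lt_top
      rw [eLpNorm_exponent_top] at this
      exact this.ne
    filter_upwards [ae_le_eLpNormEssSup (f := p) (μ := volume.restrict (interval ℓ))] with t ht
    have := ENNReal.toReal_mono hfin ht
    rwa [toReal_enorm, Real.norm_eq_abs] at this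
  have hB0 : 0 ≤ B := ENNReal.toReal_nonneg
  obtain ⟨C₀, hC₀⟩ := h.decay_zero
  obtain ⟨A₁, hA₁⟩ : ∃ A₁ : ℝ, ∀ t ∈ interval ℓ, 1 < t → |p t| ≤ B →
      |p t - pInf| * |Real.log t| ≤ A₁ := by
    by_cases hℓ : ℓ = ∞
    · obtain ⟨C, hC⟩ := h.decay_infty hℓ
      refine ⟨C, fun t ht ht1 _ => ?_⟩
      have hlog : 0 < Real.log t := Real.log_pos ht1
      have hle : Real.log t ≤ Real.log (Real.exp 1 + t) :=
        Real.log_le_log ht.1 (by linarith [Real.exp_pos 1])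
      rw [abs_of_pos hlog]
      calc |p t - pInf| * Real.log t ≤ |p t - pInf| * Real.log (Real.exp 1 + t) := by gcongr
        _ ≤ C := (le_div_iff₀ (hlog.trans_le hle)).1 (hC t ht)
    · refine ⟨(B + |pInf|) * Real.log ℓ.toReal, fun t ht ht1 hpt => ?_⟩
      have hlog : 0 < Real.log t := Real.log_pos ht1
      have hle : t < ℓ.toReal := (ENNReal.ofReal_lt_iff_lt_toReal ht.1.le hℓ).1 ht.2
      rw [abs_of_pos hlog]
      gcongr
      exact (abs_sub _ _).trans (by gcongr)
  refine ⟨max (max C₀ (B + |p₀|)) A₁, ?_⟩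
  filter_upwards [hB, ae_restrict_mem (measurableSet_interval ℓ)] with t hBt ht
  have ht0 : 0 < t := ht.1
  rcases le_or_gt t 1 with h1 | h1
  · rw [twoPiece_of_le h1]
    refine le_max_of_le_left ?_
    have hneg : Real.log t ≤ 0 := Real.log_nonpos ht0.le h1
    rcases le_or_gt t (1 / 2) with h2 | h2
    · refine le_max_of_le_left ?_
      have hpos : 0 < Real.log (1 / t) := Real.log_pos (by rw [lt_div_iff₀ ht0]; linarith)
      have := (le_div_iff₀ hpos).1 (hC₀ t ht h2)
      rwa [one_div, Real.log_inv, ← abs_of_nonpos hneg] at this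
    · refine le_max_of_le_right ?_
      have hlog : |Real.log t| ≤ 1 := by
        have h3 : Real.log (1 / 2) ≤ Real.log t := Real.log_le_log (by norm_num) h2.le
        rw [one_div, Real.log_inv] at h3
        rw [abs_of_nonpos hneg]
        linarith [Real.log_two_lt_d9]
      calc |p t - p₀| * |Real.log t| ≤ (|p t| + |p₀|) * 1 := by
            gcongr
            exact abs_sub _ _
        _ ≤ _ := by linarith
  · rw [twoPiece_of_lt h1]
    exact le_max_of_le_right (hA₁ t ht h1 hBt)

theorem abs_one_div_sub_one_div_le {x y : ℝ} (hx : 1 ≤ x) (hy : 1 ≤ y) :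
    |1 / x - 1 / y| ≤ |x - y| := by
  rw [div_sub_div _ _ (by positivity) (by positivity), one_mul, mul_one, abs_div, abs_sub_comm]
  refine div_le_self (abs_nonneg _) ?_
  rw [abs_of_pos (by positivity)]
  nlinarith

theorem luxemburgNorm_le {ℓ : ℝ≥0∞} {q : ℝ → ℝ} {h : ℝ → ℝ≥0∞} {c : ℝ≥0} (hc : 0 < c)
    (hint : ∫⁻ t in interval ℓ, (h t / c) ^ q t ≤ 1) : luxemburgNorm ℓ q h ≤ c :=
  iInf_le_of_le c (iInf₂_le_of_le hc hint le_rfl)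

theorem luxemburgNorm_zero_length (q : ℝ → ℝ) (h : ℝ → ℝ≥0∞) : luxemburgNorm 0 q h = 0 := by
  refine le_antisymm (ENNReal.le_of_forall_pos_le_add fun ε hε _ => ?_) zero_le
  rw [zero_add]
  refine luxemburgNorm_le hε ?_
  simp [interval]

/-- Hardy's inequality in weighted variable exponent Lebesgue spaces, for non-increasing
functions. -/
theorem exists_luxemburgNorm_le_of_le_hardyAverage {ℓ : ℝ≥0∞} {p q γ : ℝ → ℝ}
    {p₀ pInf q₀ qInf γ₀ γInf : ℝ} (hp : LogDecay ℓ p p₀ pInf) (hp₁ : ExponentClass ℓ 1 p)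
    (hq : LogDecay ℓ q q₀ qInf) (hq₁ : ExponentClass ℓ 1 q) (hp_zero : 1 < p₀)
    (hp_infty : 1 < pInf) (hq_zero : 1 < q₀) (hq_infty : 1 < qInf)
    (hγ : LogDecay ℓ γ γ₀ γInf) (hγ_zero : γ₀ < 1 - 1 / p₀) (hγ_infty : γInf < 1 - 1 / pInf)
    (N : ℝ≥0) :
    ∃ C : ℝ≥0, ∀ φ h : ℝ → ℝ≥0∞, Antitone φ → (∀ t, ℓ ≤ ENNReal.ofReal t → φ t = 0) →
      (∀ t, 0 < t → h t ≤ N * hardyAverage φ t) →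
        luxemburgNorm ℓ q (fun t => ENNReal.ofReal (t ^ γ t * t ^ (1 / p t - 1 / q t)) * h t) ≤
          C * luxemburgNorm ℓ q
            (fun t => ENNReal.ofReal (t ^ γ t * t ^ (1 / p t - 1 / q t)) * φ t) := by
  classical
  obtain ⟨⟨m, hm1, hm⟩, K, hK⟩ := hq₁
  obtain ⟨⟨m', hm1', hm'⟩, -⟩ := hp₁
  obtain ⟨Ap, hAp⟩ := hp.exists_log_close
  obtain ⟨Aq, hAq⟩ := hq.exists_log_close
  obtain ⟨Aγ, hAγ⟩ := hγ.exists_log_close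
  have hIm := measurableSet_interval ℓ
  have hI0 : interval ℓ ⊆ Ioi 0 := fun t ht => ht.1
  set a₀ := γ₀ + 1 / p₀ - 1 / q₀ with ha₀
  set a₁ := γInf + 1 / pInf - 1 / qInf with ha₁
  -- Beyond ℓ the exponents continue by their models, so the half-line inequality applies; φ
  -- vanishes there and the modular is unchanged.
  let Q : ℝ → ℝ := (interval ℓ).piecewise q (twoPiece q₀ qInf)
  let α : ℝ → ℝ := (interval ℓ).piecewise (fun t => γ t + 1 / p t - 1 / q t) (twoPiece a₀ a₁)
  set A := max 0 (Aγ + Ap + Aq)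
  set L := max K (max q₀ qInf)
  have hclose : ∀ᵐ t ∂volume, t ∈ interval ℓ →
      |q t - twoPiece q₀ qInf t| * |Real.log t| ≤ A ∧
      |γ t + 1 / p t - 1 / q t - twoPiece a₀ a₁ t| * |Real.log t| ≤ A := by
    rw [ae_restrict_iff' hIm] at hAp hAq hAγ
    filter_upwards [hAp, hAq, hAγ] with t h1 h2 h3 ht
    specialize h1 ht
    specialize h2 ht
    specialize h3 ht
    have hl := abs_nonneg (Real.log t)
    have n1 := mul_nonneg (abs_nonneg (p t - twoPiece p₀ pInf t)) hl
    have n3 := mul_nonneg (abs_nonneg (γ t - twoPiece γ₀ γInf t)) hl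
    refine ⟨le_max_of_le_right (by linarith), le_max_of_le_right ?_⟩
    have hsplit : γ t + 1 / p t - 1 / q t - twoPiece a₀ a₁ t = (γ t - twoPiece γ₀ γInf t) +
        (1 / p t - 1 / twoPiece p₀ pInf t) - (1 / q t - 1 / twoPiece q₀ qInf t) := by
      unfold twoPiece
      split_ifs
      · rw [ha₀]; ring
      · rw [ha₁]; ring
    have hP : 1 ≤ twoPiece p₀ pInf t := by
      unfold twoPiece
      split_ifs <;> linarith
    have hQ : 1 ≤ twoPiece q₀ qInf t := by
      unfold twoPiece
      split_ifs <;> linarith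
    have hle : |γ t + 1 / p t - 1 / q t - twoPiece a₀ a₁ t| ≤ |γ t - twoPiece γ₀ γInf t| +
        |p t - twoPiece p₀ pInf t| + |q t - twoPiece q₀ qInf t| := by
      rw [hsplit]
      refine (abs_sub _ _).trans (add_le_add ((abs_add_le _ _).trans (add_le_add le_rfl ?_)) ?_)
      · exact abs_one_div_sub_one_div_le (hm1'.le.trans (hm' t ht)) hP
      · exact abs_one_div_sub_one_div_le (hm1.le.trans (hm t ht)) hQ
    calc _ ≤ (|γ t - twoPiece γ₀ γInf t| + |p t - twoPiece p₀ pInf t| +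
          |q t - twoPiece q₀ qInf t|) * |Real.log t| := by gcongr
      _ ≤ _ := by linarith
  obtain ⟨C, hC⟩ := exists_modular_hardyAverage_le (q := Q) (α := α) (q₀ := q₀) (q₁ := qInf)
    (a₀ := a₀) (a₁ := a₁) (K := L) (A := A) hq_zero hq_infty (by rw [ha₀]; linarith)
    (by rw [ha₁]; linarith) (le_max_of_le_right (le_max_left _ _))
    (le_max_of_le_right (le_max_right _ _))
    (by
      filter_upwards [ae_restrict_of_ae hclose] with t ht
      by_cases hI : t ∈ interval ℓ
      · simp only [Q, piecewise_eq_of_mem _ _ _ hI]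
        exact ⟨hm1.le.trans (hm t hI), le_max_of_le_left (hK t hI), (ht hI).1⟩
      · simp only [Q, piecewise_eq_of_notMem _ _ _ hI, sub_self, abs_zero, zero_mul]
        refine ⟨?_, le_max_of_le_right ?_, le_max_left _ _⟩
        · unfold twoPiece
          split_ifs <;> linarith
        · unfold twoPiece
          split_ifs
          exacts [le_max_left _ _, le_max_right _ _])
    (by
      filter_upwards [ae_restrict_of_ae hclose] with t ht
      by_cases hI : t ∈ interval ℓ
      · simp only [α, piecewise_eq_of_mem _ _ _ hI]
        exact (ht hI).2
      · simp only [α, piecewise_eq_of_notMem _ _ _ hI, sub_self, abs_zero, zero_mul]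
        exact le_max_left _ _)
  have hweight : ∀ t ∈ interval ℓ, t ^ γ t * t ^ (1 / p t - 1 / q t) = t ^ α t := by
    intro t ht
    simp only [α, piecewise_eq_of_mem _ _ _ ht]
    rw [← Real.rpow_add ht.1, add_sub_assoc]
  -- With C' ≥ 1 and q ≥ 1, (1/C')^q ≤ 1/C': dividing the function by C' brings a modular bounded by
  -- C down to at most 1.
  set C' : ℝ≥0 := max C 1
  set N' : ℝ≥0 := max N 1
  have hC' : 0 < C' := lt_max_of_lt_right one_pos
  have hN' : 0 < N' := lt_max_of_lt_right one_pos
  have hC'0 : (C' : ℝ≥0∞) ≠ 0 := by exact_mod_cast hC'.ne'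
  have hN'0 : (N' : ℝ≥0∞) ≠ 0 := by exact_mod_cast hN'.ne'
  refine ⟨N' * C', fun φ h hφ hφ0 hh => ?_⟩
  have hNC : ((N' * C' : ℝ≥0) : ℝ≥0∞) ≠ 0 := by exact_mod_cast (mul_pos hN' hC').ne'
  rw [mul_comm, ← ENNReal.div_le_iff_le_mul (Or.inl hNC) (Or.inl ENNReal.coe_ne_top)]
  refine le_iInf₂ fun c hc => le_iInf fun hint => ?_
  rw [ENNReal.div_le_iff_le_mul (Or.inl hNC) (Or.inl ENNReal.coe_ne_top), mul_comm,
    ← ENNReal.coe_mul]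
  refine luxemburgNorm_le (mul_pos (mul_pos hN' hC') hc) ?_
  have hc0 : (c : ℝ≥0∞) ≠ 0 := by exact_mod_cast hc.ne'
  have hψ : Antitone fun t => φ t / c := fun s t hst => ENNReal.div_le_div_right (hφ hst) _
  have hψint : ∫⁻ t in Ioi 0, (ENNReal.ofReal (t ^ α t) * (φ t / c)) ^ Q t ≤ 1 := by
    refine le_trans (le_of_eq ?_) hint
    have hind : ∀ t ∈ Ioi (0 : ℝ), (ENNReal.ofReal (t ^ α t) * (φ t / c)) ^ Q t =
        (interval ℓ).indicator (fun t =>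
          (ENNReal.ofReal (t ^ γ t * t ^ (1 / p t - 1 / q t)) * φ t / c) ^ q t) t := by
      intro t ht
      by_cases hI : t ∈ interval ℓ
      · simp only [indicator_of_mem hI, hweight t hI, Q, piecewise_eq_of_mem _ _ _ hI,
          mul_div_assoc]
      · have hz : φ t = 0 := hφ0 t (not_lt.1 fun hlt => hI ⟨ht, hlt⟩)
        have hQ : 0 < Q t := by
          simp only [Q, piecewise_eq_of_notMem _ _ _ hI]
          unfold twoPiece
          split_ifs <;> linarith
        rw [indicator_of_notMem hI, hz, ENNReal.zero_div, mul_zero, ENNReal.zero_rpow_of_pos hQ]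
    rw [setLIntegral_congr_fun measurableSet_Ioi hind, lintegral_indicator hIm,
      Measure.restrict_restrict hIm, inter_eq_self_of_subset_left hI0]
  have hH : ∀ t, hardyAverage (fun t => φ t / c) t = hardyAverage φ t / c := by
    intro t
    simp only [hardyAverage, div_eq_mul_inv]
    rw [lintegral_mul_const' _ _ (ENNReal.inv_ne_top.2 hc0), mul_right_comm]
  calc ∫⁻ t in interval ℓ, (ENNReal.ofReal (t ^ γ t * t ^ (1 / p t - 1 / q t)) * h t /
        ((N' * C' * c : ℝ≥0) : ℝ≥0∞)) ^ q t
      ≤ ∫⁻ t in interval ℓ, (C' : ℝ≥0∞)⁻¹ * (ENNReal.ofReal (t ^ α t) *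
          hardyAverage (fun t => φ t / c) t) ^ Q t := by
        refine setLIntegral_mono' hIm fun t ht => ?_
        have hq1 : 1 ≤ q t := hm1.le.trans (hm t ht)
        rw [hweight t ht, hH, show Q t = q t from piecewise_eq_of_mem _ _ _ ht]
        have hhN : h t ≤ N' * hardyAverage φ t :=
          (hh t ht.1).trans (by gcongr; exact le_max_left _ _)
        have hbase : ENNReal.ofReal (t ^ α t) * h t / ((N' * C' * c : ℝ≥0) : ℝ≥0∞) ≤
            (C' : ℝ≥0∞)⁻¹ * (ENNReal.ofReal (t ^ α t) * (hardyAverage φ t / c)) :=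
          calc ENNReal.ofReal (t ^ α t) * h t / ((N' * C' * c : ℝ≥0) : ℝ≥0∞)
              ≤ ENNReal.ofReal (t ^ α t) * (N' * hardyAverage φ t) /
                ((N' * C' * c : ℝ≥0) : ℝ≥0∞) := by gcongr
            _ = N' * (N' : ℝ≥0∞)⁻¹ * ((C' : ℝ≥0∞)⁻¹ *
                (ENNReal.ofReal (t ^ α t) * (hardyAverage φ t / c))) := by
                rw [ENNReal.coe_mul, ENNReal.coe_mul, div_eq_mul_inv, div_eq_mul_inv,
                  ENNReal.mul_inv (Or.inr ENNReal.coe_ne_top) (Or.inr hc0),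
                  ENNReal.mul_inv (Or.inl hN'0) (Or.inl ENNReal.coe_ne_top)]
                ring
            _ = _ := by rw [ENNReal.mul_inv_cancel hN'0 ENNReal.coe_ne_top, one_mul]
        calc _ ≤ ((C' : ℝ≥0∞)⁻¹ * (ENNReal.ofReal (t ^ α t) * (hardyAverage φ t / c))) ^ q t := by
              gcongr
          _ = ((C' : ℝ≥0∞)⁻¹) ^ q t *
              (ENNReal.ofReal (t ^ α t) * (hardyAverage φ t / c)) ^ q t :=
              ENNReal.mul_rpow_of_nonneg _ _ (by linarith)
          _ ≤ _ := by
              gcongr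
              refine ENNReal.rpow_le_self_of_le_one ?_ hq1
              exact ENNReal.inv_le_one.2 (by exact_mod_cast le_max_right C 1)
    _ ≤ ∫⁻ t in Ioi 0, (C' : ℝ≥0∞)⁻¹ * (ENNReal.ofReal (t ^ α t) *
          hardyAverage (fun t => φ t / c) t) ^ Q t := lintegral_mono_set hI0
    _ = (C' : ℝ≥0∞)⁻¹ * ∫⁻ t in Ioi 0, (ENNReal.ofReal (t ^ α t) *
          hardyAverage (fun t => φ t / c) t) ^ Q t :=
        lintegral_const_mul' _ _ (ENNReal.inv_ne_top.2 hC'0)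
    _ ≤ (C' : ℝ≥0∞)⁻¹ * C' := by
        gcongr
        exact (hC _ hψ hψint).trans (by exact_mod_cast le_max_left C 1)
    _ = 1 := ENNReal.inv_mul_cancel hC'0 ENNReal.coe_ne_top

end Luxemburg

end VariableLorentz

/-! ### Boundedness of the maximal operator -/

theorem mainTheorem1 {𝕜 : Type*} [RCLike 𝕜] {n : ℕ} (Ω : Set (EuclideanSpace ℝ (Fin n)))
    (hΩ : IsOpen Ω) (μ : Measure Ω) (p q γ : ℝ → ℝ) (p₀ pInf q₀ qInf γ₀ γInf : ℝ)
    (hp : VariableLorentz.LogDecay (μ univ) p p₀ pInf)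
    (hp₁ : VariableLorentz.ExponentClass (μ univ) 1 p)
    (hq : VariableLorentz.LogDecay (μ univ) q q₀ qInf)
    (hq₁ : VariableLorentz.ExponentClass (μ univ) 1 q)
    (hp_zero : 1 < p₀) (hp_infty : μ univ = ∞ → 1 < pInf)
    (hγ : VariableLorentz.LogDecay (μ univ) γ γ₀ γInf)
    (hγ_zero : γ₀ < 1 - 1 / p₀) (hγ_infty : μ univ = ∞ → γInf < 1 - 1 / pInf) :
    ∃ C : ℝ≥0, ∀ f : Ω → 𝕜,
      VariableLorentz.MemLorentz μ p q (fun t => t ^ γ t) f →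
        VariableLorentz.MemLorentz μ p q (fun t => t ^ γ t)
            (VariableLorentz.maximalFunction μ f) ∧
          VariableLorentz.lorentzNorm μ p q (fun t => t ^ γ t)
              (VariableLorentz.maximalFunction μ f) ≤
            C * VariableLorentz.lorentzNorm μ p q (fun t => t ^ γ t) f := by
  open VariableLorentz in
  have : HasBesicovitchCovering Ω := hasBesicovitchCovering_subtype Ω
  suffices H : ∃ C : ℝ≥0, ∀ f : Ω → 𝕜, AEStronglyMeasurable f μ →
      lorentzNorm μ p q (fun t => t ^ γ t) (maximalFunction μ f) ≤
        C * lorentzNorm μ p q (fun t => t ^ γ t) f by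
    obtain ⟨C, hC⟩ := H
    refine ⟨C, fun f hf => ⟨⟨?_, (hC f hf.1).trans_lt ?_⟩, hC f hf.1⟩⟩
    · exact (measurable_centredMaximal μ fun x => ‖f x‖ₑ).aestronglyMeasurable
    · exact ENNReal.mul_lt_top ENNReal.coe_lt_top hf.2
  -- For μ = 0 the interval is empty, so inf q > 1 says nothing about q₀; all norms are 0.
  by_cases hℓ : μ univ = 0
  · refine ⟨0, fun f _ => ?_⟩
    unfold lorentzNorm
    rw [hℓ, luxemburgNorm_zero_length]
    exact zero_le
  have hq_zero : 1 < q₀ := by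
    obtain ⟨⟨m, hm1, hm⟩, -⟩ := hq₁
    refine hm1.trans_le (ge_of_tendsto hq.tendsto_zero ?_)
    filter_upwards [eventually_mem_interval hℓ] with t ht using hm t ht
  obtain ⟨N, hN⟩ := exists_rearrangement_centredMaximal_le Ω
  have key : ∃ C : ℝ≥0, ∀ φ h : ℝ → ℝ≥0∞, Antitone φ →
      (∀ t, μ univ ≤ ENNReal.ofReal t → φ t = 0) →
      (∀ t, 0 < t → h t ≤ (N : ℝ≥0) * hardyAverage φ t) →
        luxemburgNorm (μ univ) q
            (fun t => ENNReal.ofReal (t ^ γ t * t ^ (1 / p t - 1 / q t)) * h t) ≤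
          C * luxemburgNorm (μ univ) q
            (fun t => ENNReal.ofReal (t ^ γ t * t ^ (1 / p t - 1 / q t)) * φ t) := by
    by_cases htop : μ univ = ∞
    · have hq_infty : 1 < qInf := by
        obtain ⟨⟨m, hm1, hm⟩, -⟩ := hq₁
        refine hm1.trans_le (ge_of_tendsto (hq.tendsto_infty htop) ?_)
        filter_upwards [eventually_gt_atTop 0] with t ht
        exact hm t ⟨ht, htop ▸ ENNReal.ofReal_lt_top⟩
      exact exists_luxemburgNorm_le_of_le_hardyAverage hp hp₁ hq hq₁ hp_zero (hp_infty htop)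
        hq_zero hq_infty hγ hγ_zero (hγ_infty htop) N
    · exact exists_luxemburgNorm_le_of_le_hardyAverage (hp.of_ne_top htop p₀) hp₁
        (hq.of_ne_top htop q₀) hq₁ hp_zero hp_zero hq_zero hq_zero (hγ.of_ne_top htop γ₀)
        hγ_zero hγ_zero N
  obtain ⟨C, hC⟩ := key
  refine ⟨C, fun f hf => hC _ _ (rearrangement_antitone μ f)
    (fun t ht => rearrangement_eq_zero μ f ht) fun t ht => ?_⟩
  exact_mod_cast hN μ f hf t ht
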